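/- Let $n\ge 1$, $m\in\mathbb R\setminus\{0,1\}$, $p\in\mathbb Z_2$, and let $G=SL(2,\mathbb R)\times SO(n+1,1)_0$, where $SO(n+1,1)_0$ is the identity component of $SO(n+1,1)$ for the form $\mathrm{diag}(1,\dots,1,-1)$. For $a>0$, $y,t\in\mathbb R$, $x\in\mathbb R^n$, $j\in\mathbb Z_2$, $B\in SO(n)$ put $$h_{a,y}=\Big[\begin{pmatrix}a&0\\0&a^{-1}\end{pmatrix},\begin{pmatrix}I_n&0&0\\0&\cosh y&\sinh y\\0&\sinh y&\cosh y\end{pmatrix}\Big],\qquad m_{j,B}=\Big[(-I_2)^j,\begin{pmatrix}B&0\\0&I_2\end{pmatrix}\Big],$$ $$n_{t,x}=\Big[\begin{pmatrix}1&t\\0&1\end{pmatrix},\begin{pmatrix}I_n&-x&x\\x^T&1-\frac{\|x\|^2}2&\frac{\|x\|^2}2\\x^T&-\frac{\|x\|^2}2&1+\frac{\|x\|^2}2\end{pmatrix}\Big],\qquad n^-_{t,x}=\Big[\begin{pmatrix}1&0\\t&1\end{pmatrix},\begin{pmatrix}I_n&x&x\\-x^T&1-\frac{\|x\|^2}2&-\frac{\|x\|^2}2\\x^T&\frac{\|x\|^2}2&1+\frac{\|x\|^2}2\end{pmatrix}\Big].$$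 Let $Q^-=\{m_{j,B}h_{a,y}n^-_{t,x}\}$ with the character $\chi_{p,r,s}(m_{j,B}h_{a,y}n^-_{t,x})=(-1)^{jp}a^re^{sy}$, let $\mathrm{Ind}_{Q^-}^G(\chi_{p,r,s})$ be the space of all $\varphi\in C^\infty(G)$ (complex valued) with $\varphi(gq)=\chi_{p,r,s}(q)^{-1}\varphi(g)$ for $g\in G$, $q\in Q^-$, with $G$ acting by left translation, $(g\varphi)(h)=\varphi(g^{-1}h)$, and let $I'(p,r,s)$ be the space of all functions $f(t,x)=\varphi(n_{t,x})$ on $\mathbb R^{1,n}$ with $\varphi\in\mathrm{Ind}_{Q^-}^G(\chi_{p,r,s})$. The symmetry algebra of $u_t=\Delta_n(u^m)$ is the span $\mathfrak s_m$ of the vector fields $$X_1=\partial_t,\quad X_2=\sum_i x_i\partial_i+\tfrac{2u}{m-1}\partial_u,\quad X_3=-t\partial_t+\tfrac{u}{m-1}\partial_u,\quad Y_i=\partial_i,\quad Z_{i,j}=x_i\partial_j-x_j\partial_i\ (i<j),$$ and, if (and only if) $m=\frac{n-2}{n+2}$, also of $$W_i=\Big(x_i^2-\sum_{j\ne i}x_j^2\Big)\partial_i+\sum_{j\neq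 i}2x_ix_j\partial_j+\tfrac{4x_iu}{m-1}\partial_u .$$ Let $v\mapsto A_v$ be the linear map from $\mathfrak s_m$ to the Lie algebra $\mathfrak{sl}(2,\mathbb R)\oplus\mathfrak{so}(n+1,1)$ of $G$ with ($E_{k,l}$ being the matrix units) $$X_1\mapsto\begin{pmatrix}0&1\\0&0\end{pmatrix},\quad X_3\mapsto\begin{pmatrix}-\frac12&0\\0&\frac12\end{pmatrix},\quad X_2\mapsto E_{n+1,n+2}+E_{n+2,n+1},\quad Z_{i,j}\mapsto E_{j,i}-E_{i,j},$$ $$Y_i\mapsto E_{n+1,i}-E_{i,n+1}+E_{n+2,i}+E_{i,n+2},\qquad W_i\mapsto E_{n+1,i}-E_{i,n+1}-E_{n+2,i}-E_{i,n+2},$$ and let the symmetry group $S_m\subset G$ be the subgroup generated by all $\exp(\varepsilon A_v)$ with $v\in\mathfrak s_m$ and $\varepsilon\in\mathbb R$. **Theorem.** Let $r=-\frac{2}{m-1}$ and $s=\frac{2}{m-1}$. Then $I'(p,r,s)\subset C^\infty(\mathbb R^{1,n})$, the restriction map $\varphi\mapsto f$ from $\mathrm{Ind}_{Q^-}^G(\chi_{p,r,s})$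 onto $I'(p,r,s)$ is injective, and $I'(p,r,s)$ carries a linear action of $G$ for which this map is intertwining. The restriction of this action to $S_m$ is a global action of the symmetry group on $I'(p,r,s)$ that globalizes the local point-symmetry action: 1. For all $v\in\mathfrak s_m$ (including the $W_i$ if $m=\frac{n-2}{n+2}$), all $\varepsilon\in\mathbb R$ and all $f\in I'(p,r,s)$, the time-$\varepsilon$ map of the local flow of $v$ on the space of $(t,x,u)$, $u\in\mathbb C$, maps every point of the graph of $f$ at which it is defined to a point of the graph of $\exp(\varepsilon A_v).f$. 2. Elements of $S_m$ map solutions to solutions: if $g\in S_m$, $f\in I'(p,r,s)$, and $f$ is a classical solution of $u_t=\Delta_n(u^m)$ on an open set $U\subset\mathbb R^{1,n}$, then $g.f$ is a classical solution on the set of all $(t',x')$ such that $g\,n_{t,x}\in n_{t',x'}Q^-$ for some $(t,x)\in U$. Here $u\mapsto u^m$ may be any function $P:\mathbb C\to\mathbb C$ with $P(y)=y^m$ for $y>0$ and $P(\lambda y)=\lambda^mP(y)$ for all $\lambda>0$, $y\in\mathbb C$; for $f>0$ on $U$ this is the usual power. A classical solution is one for which $u_t$ exists, $x\mapsto u^m$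 is $C^2$, and the equation holds. -/

import Mathlib

open Matrix
open scoped ContDiff Topology

noncomputable section

namespace PorousMedium

/-- Indices of `(n+2) × (n+2)` matrices: `inl i` is the `i`-th index for `1 ≤ i ≤ n`, `inr 0` is the
index `n + 1` and `inr 1` is the index `n + 2`. -/
abbrev Idx (n : ℕ) : Type := Fin n ⊕ Fin 2

/-- The space `ℝⁿ` with its Euclidean norm. -/
abbrev Space (n : ℕ) : Type := EuclideanSpace ℝ (Fin n)

/-- The space `ℝ^{1,n}` of pairs `(t, x)`. -/
abbrev SpaceTime (n : ℕ) : Type := ℝ × Space n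

/-! ### The group -/

/-- The quadratic form of signature `(n+1, 1)`. -/
def form (n : ℕ) : Matrix (Idx n) (Idx n) ℝ :=
  fromBlocks 1 0 0 !![1, 0; 0, -1]

/-- The group `SO(n+1,1)`. -/
def SOnOne (n : ℕ) : Subgroup (SpecialLinearGroup (Idx n) ℝ) where
  carrier := {A | A.1ᵀ * form n * A.1 = form n}
  one_mem' := by
    change (1 : Matrix (Idx n) (Idx n) ℝ)ᵀ * form n * 1 = form n
    simp
  mul_mem' := by
    intro A B hA hB
    change A.1ᵀ * form n * A.1 = form n at hA
    change B.1ᵀ * form n * B.1 = form n at hB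
    change (A.1 * B.1)ᵀ * form n * (A.1 * B.1) = form n
    calc _ = B.1ᵀ * (A.1ᵀ * form n * A.1) * B.1 := by
            rw [transpose_mul]
            simp only [Matrix.mul_assoc]
      _ = form n := by rw [hA, hB]
  inv_mem' := by
    intro A hA
    change A.1ᵀ * form n * A.1 = form n at hA
    change (A⁻¹).1ᵀ * form n * (A⁻¹).1 = form n
    have h1 : A.1 * (A⁻¹).1 = 1 := congrArg Subtype.val (mul_inv_cancel A)
    have h2 : (A⁻¹).1ᵀ * A.1ᵀ = 1 := by
      rw [← transpose_mul, h1, transpose_one]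
    calc (A⁻¹).1ᵀ * form n * (A⁻¹).1
        = (A⁻¹).1ᵀ * (A.1ᵀ * form n * A.1) * (A⁻¹).1 := by rw [hA]
      _ = ((A⁻¹).1ᵀ * A.1ᵀ) * form n * (A.1 * (A⁻¹).1) := by simp only [Matrix.mul_assoc]
      _ = form n := by rw [h1, h2, one_mul, mul_one]

/-- The identity component `SO(n+1,1)₀`. -/
def SOnOneId (n : ℕ) : Subgroup (SpecialLinearGroup (Idx n) ℝ) :=
  (Subgroup.connectedComponentOfOne (SOnOne n)).map (SOnOne n).subtype

/-- The group `G = SL(2,ℝ) × SO(n+1,1)₀`. -/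
abbrev G (n : ℕ) : Type := SpecialLinearGroup (Fin 2) ℝ × SOnOneId n

/-- The `SL(2,ℝ)` component of an element of `G`, as a matrix. -/
def mat₁ {n : ℕ} (g : G n) : Matrix (Fin 2) (Fin 2) ℝ := g.1

/-- The `SO(n+1,1)₀` component of an element of `G`, as a matrix. -/
def mat₂ {n : ℕ} (g : G n) : Matrix (Idx n) (Idx n) ℝ := (g.2 : SpecialLinearGroup (Idx n) ℝ)

/-! ### The subgroups `M`, `A`, `N`, `N⁻` and `Q⁻ = M A N⁻` -/

/-- The `(n+2) × (n+2)` component of `n_{t,x}`. -/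
def nPlusMat {n : ℕ} (x : Space n) : Matrix (Idx n) (Idx n) ℝ :=
  fromBlocks 1 (Matrix.of fun i => ![-x i, x i]) (Matrix.of fun _ i => x i)
    !![1 - ‖x‖ ^ 2 / 2, ‖x‖ ^ 2 / 2; -(‖x‖ ^ 2 / 2), 1 + ‖x‖ ^ 2 / 2]

/-- The `(n+2) × (n+2)` component of `n⁻_{t,x}`. -/
def nMinusMat {n : ℕ} (x : Space n) : Matrix (Idx n) (Idx n) ℝ :=
  fromBlocks 1 (Matrix.of fun i => ![x i, x i]) (Matrix.of ![fun i => -x i, fun i => x i])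
    !![1 - ‖x‖ ^ 2 / 2, -(‖x‖ ^ 2 / 2); ‖x‖ ^ 2 / 2, 1 + ‖x‖ ^ 2 / 2]

/-- The `(n+2) × (n+2)` component of `h_{a,y}`. -/
def hMat (n : ℕ) (y : ℝ) : Matrix (Idx n) (Idx n) ℝ :=
  fromBlocks 1 0 0 !![Real.cosh y, Real.sinh y; Real.sinh y, Real.cosh y]

/-- The `(n+2) × (n+2)` component of `m_{j,B}`. -/
def mMat {n : ℕ} (B : Matrix (Fin n) (Fin n) ℝ) : Matrix (Idx n) (Idx n) ℝ :=
  fromBlocks B 0 0 1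

/-- Parameters of a product `m_{j,B} h_{a,y} n⁻_{t,x}`, with `j ∈ ℤ/2`, `B ∈ SO(n)`, `a > 0`,
`y, t ∈ ℝ` and `x ∈ ℝⁿ`. -/
structure QParam (n : ℕ) where
  j : ZMod 2
  B : Matrix.specialOrthogonalGroup (Fin n) ℝ
  a : ℝ
  a_pos : 0 < a
  y : ℝ
  t : ℝ
  x : Space n

/-- `q = m_{j,B} h_{a,y} n⁻_{t,x}` in `G`. Thus `q` lies in `Q⁻` if and only if
`IsQMinus k q` for some `k`. -/
def IsQMinus {n : ℕ} (k : QParam n) (q : G n) : Prop :=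
  mat₁ q = !![-1, 0; 0, -1] ^ k.j.val * !![k.a, 0; 0, k.a⁻¹] * !![1, 0; k.t, 1] ∧
  mat₂ q = mMat (k.B : Matrix (Fin n) (Fin n) ℝ) * hMat n k.y * nMinusMat k.x

/-- The value `(-1)^{jp} a^r e^{sy}` of the character `χ_{p,r,s}` at `m_{j,B} h_{a,y} n⁻_{t,x}`. -/
def QParam.chi {n : ℕ} (p : ZMod 2) (r s : ℂ) (k : QParam n) : ℂ :=
  (-1) ^ (k.j.val * p.val) * (k.a : ℂ) ^ r * Complex.exp (s * k.y)

theorem nPlusMat_det {n : ℕ} (x : Space n) : (nPlusMat x).det = 1 := by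
  have hx : ‖x‖ ^ 2 = ∑ i, x i * x i := by
    rw [EuclideanSpace.real_norm_sq_eq]
    exact Finset.sum_congr rfl fun i _ => by ring
  rw [nPlusMat, det_fromBlocks_one₁₁, det_fin_two]
  simp [Matrix.mul_apply, hx]
  ring

theorem nPlusMat_form {n : ℕ} (x : Space n) :
    (nPlusMat x)ᵀ * form n * nPlusMat x = form n := by
  have hx : ‖x‖ ^ 2 = ∑ i, x i * x i := by
    rw [EuclideanSpace.real_norm_sq_eq]
    exact Finset.sum_congr rfl fun i _ => by ring
  rw [nPlusMat, form, fromBlocks_transpose, fromBlocks_multiply, fromBlocks_multiply]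
  congr 1
  · ext i j
    simp [Matrix.mul_apply, Fin.sum_univ_two]
  · ext i j
    fin_cases j <;> simp [Matrix.mul_apply, Fin.sum_univ_two] <;> ring
  · ext i j
    fin_cases i <;> simp [Matrix.mul_apply, Fin.sum_univ_two] <;> ring
  · ext i j
    fin_cases i <;> fin_cases j <;> simp [Matrix.mul_apply, Fin.sum_univ_two, hx] <;> ring

/-- `n_{t,x}` as an element of `SO(n+1,1)`. -/
def nPlusSO {n : ℕ} (x : Space n) : SOnOne n :=
  ⟨⟨nPlusMat x, nPlusMat_det x⟩, nPlusMat_form x⟩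

theorem continuous_nPlusSO (n : ℕ) : Continuous (nPlusSO : Space n → SOnOne n) := by
  refine Continuous.subtype_mk (Continuous.subtype_mk ?_ _) _
  unfold nPlusMat
  refine Continuous.matrix_fromBlocks continuous_const ?_ ?_ ?_
  · refine continuous_matrix fun i j => ?_
    fin_cases j <;> simp <;> fun_prop
  · refine continuous_matrix fun i j => ?_
    simp
    fun_prop
  · refine continuous_matrix fun i j => ?_
    fin_cases i <;> fin_cases j <;> simp <;> fun_prop

theorem nPlusSO_zero (n : ℕ) : nPlusSO (0 : Space n) = 1 := by
  apply Subtype.ext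
  apply Subtype.ext
  change nPlusMat (0 : Space n) = 1
  ext i j
  rcases i with i | i <;> rcases j with j | j
  · simp [nPlusMat, Matrix.one_apply]
  · fin_cases j <;> simp [nPlusMat]
  · simp [nPlusMat]
  · fin_cases i <;> fin_cases j <;> simp [nPlusMat]

theorem nPlusSO_mem {n : ℕ} (x : Space n) :
    (nPlusSO x : SpecialLinearGroup (Idx n) ℝ) ∈ SOnOneId n := by
  refine ⟨nPlusSO x, ?_, rfl⟩
  have h := (isPreconnected_range (continuous_nPlusSO n)).subset_connectedComponent
    (x := (1 : SOnOne n)) ⟨0, nPlusSO_zero n⟩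
  exact h ⟨x, rfl⟩

/-- The element `n_{t,x}` of `N ⊂ G`. -/
def nPlus {n : ℕ} (z : SpaceTime n) : G n :=
  (⟨!![1, z.1; 0, 1], by simp [det_fin_two]⟩, ⟨nPlusSO z.2, nPlusSO_mem z.2⟩)

/-! ### The induced picture and the non-compact picture -/

/-- `φ` is of class `C^∞` on `G`, as a function on an embedded submanifold of the vector space of
pairs of matrices: near every point it is the restriction of a smooth function on that space. -/
def IsSmooth {n : ℕ} (φ : G n → ℂ) : Prop :=
  ∀ g : G n, ∃ F : (Fin 2 → Fin 2 → ℝ) × (Idx n → Idx n → ℝ) → ℂ,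
    ContDiff ℝ ∞ F ∧
      ∀ᶠ h in 𝓝 g, φ h = F (fun i j => mat₁ h i j, fun i j => mat₂ h i j)

/-- The induced picture `Ind_{Q⁻}^G(χ_{p,r,s})`. -/
def Ind (n : ℕ) (p : ZMod 2) (r s : ℂ) : Submodule ℂ (G n → ℂ) where
  carrier := {φ | IsSmooth φ ∧
    ∀ (g q : G n) (k : QParam n), IsQMinus k q → φ (g * q) = (k.chi p r s)⁻¹ * φ g}
  zero_mem' := ⟨fun _ => ⟨0, contDiff_const, by simp⟩, by simp⟩
  add_mem' := by
    rintro φ ψ ⟨hφ, hφ'⟩ ⟨hψ, hψ'⟩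
    refine ⟨fun g => ?_, fun g q k hk => ?_⟩
    · obtain ⟨F, hF, hF'⟩ := hφ g
      obtain ⟨K, hK, hK'⟩ := hψ g
      refine ⟨F + K, hF.add hK, ?_⟩
      filter_upwards [hF', hK'] with h h1 h2
      simp [h1, h2]
    · simp [hφ' g q k hk, hψ' g q k hk, mul_add]
  smul_mem' := by
    rintro c φ ⟨hφ, hφ'⟩
    refine ⟨fun g => ?_, fun g q k hk => ?_⟩
    · obtain ⟨F, hF, hF'⟩ := hφ g
      refine ⟨fun w => c * F w, contDiff_const.mul hF, ?_⟩
      filter_upwards [hF'] with h h1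
      simp [h1]
    · simp [hφ' g q k hk, mul_left_comm]

theorem IsSmooth.translate {n : ℕ} {φ : G n → ℂ} (hφ : IsSmooth φ) (g : G n) :
    IsSmooth fun h => φ (g⁻¹ * h) := by
  intro h
  obtain ⟨F, hF, hF'⟩ := hφ (g⁻¹ * h)
  refine ⟨fun w => F (fun i j => ∑ l, mat₁ g⁻¹ i l * w.1 l j,
    fun i j => ∑ l, mat₂ g⁻¹ i l * w.2 l j), ?_, ?_⟩
  · refine hF.comp ?_
    fun_prop
  · have hc : Filter.Tendsto (fun h' : G n => g⁻¹ * h') (𝓝 h) (𝓝 (g⁻¹ * h)) :=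
      (continuous_const_mul g⁻¹).tendsto h
    filter_upwards [hc.eventually hF'] with h' h1
    exact h1

/-- The action of `G` on the induced picture by left translation, `(g • φ)(h) = φ(g⁻¹ h)`. -/
def leftTranslation (n : ℕ) (p : ZMod 2) (r s : ℂ) : Representation ℂ (G n) (Ind n p r s) where
  toFun g :=
    { toFun := fun φ => ⟨fun h => φ.1 (g⁻¹ * h), φ.2.1.translate g, fun h q k hk => by
        change φ.1 (g⁻¹ * (h * q)) = (k.chi p r s)⁻¹ * φ.1 (g⁻¹ * h)
        rw [← mul_assoc]
        exact φ.2.2 (g⁻¹ * h) q k hk⟩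
      map_add' := fun _ _ => rfl
      map_smul' := fun _ _ => rfl }
  map_one' := by
    ext φ h
    simp
  map_mul' g g' := by
    ext φ h
    simp [mul_assoc]

/-- The restriction map `φ ↦ ((t, x) ↦ φ(n_{t,x}))`. -/
def restrict (n : ℕ) (p : ZMod 2) (r s : ℂ) : Ind n p r s →ₗ[ℂ] (SpaceTime n → ℂ) where
  toFun φ z := φ.1 (nPlus z)
  map_add' _ _ := rfl
  map_smul' _ _ := rfl

/-- The non-compact picture `I'(p,r,s)`. -/
def I' (n : ℕ) (p : ZMod 2) (r s : ℂ) : Submodule ℂ (SpaceTime n → ℂ) :=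
  LinearMap.range (restrict n p r s)

/-! ### The local symmetries of the equation `u_t = Δ(u^m)` -/

/-- Names of the infinitesimal point symmetries. -/
inductive Gen (n : ℕ) : Type
  | X1 : Gen n
  | X2 : Gen n
  | X3 : Gen n
  | Y (i : Fin n) : Gen n
  | Z (i j : Fin n) : Gen n
  | W (i : Fin n) : Gen n

/-- The generators that belong to the symmetry algebra of `u_t = Δ(u^m)`: the `W i` occur only for
`m = (n-2)/(n+2)`, and the `Z i j` are listed for `i < j`. -/
def Gen.IsSymmetry {n : ℕ} (m : ℝ) : Gen n → Prop
  | X1 => True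
  | X2 => True
  | X3 => True
  | Y _ => True
  | Z i j => i < j
  | W _ => m = ((n : ℝ) - 2) / ((n : ℝ) + 2)

/-- The generators as vector fields on the space of `((t, x), u)`:
`X1 = ∂_t`, `X2 = ∑ x_i ∂_i + (2u/(m-1)) ∂_u`, `X3 = -t ∂_t + (u/(m-1)) ∂_u`, `Y i = ∂_i`,
`Z i j = x_i ∂_j - x_j ∂_i` and
`W i = (x_i² - ∑_{j ≠ i} x_j²) ∂_i + ∑_{j ≠ i} 2 x_i x_j ∂_j + (4 x_i u/(m-1)) ∂_u`. -/
def Gen.field {n : ℕ} (m : ℝ) : Gen n → SpaceTime n × ℂ → SpaceTime n × ℂ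
  | X1, _ => ((1, 0), 0)
  | X2, w => ((0, w.1.2), ((2 / (m - 1) : ℝ) : ℂ) * w.2)
  | X3, w => ((-w.1.1, 0), ((1 / (m - 1) : ℝ) : ℂ) * w.2)
  | Y i, _ => ((0, EuclideanSpace.single i 1), 0)
  | Z i j, w => ((0, EuclideanSpace.single j (w.1.2 i) - EuclideanSpace.single i (w.1.2 j)), 0)
  | W i, w => ((0, WithLp.toLp 2 fun j =>
        if j = i then w.1.2 i ^ 2 - ∑ l ∈ Finset.univ.erase i, w.1.2 l ^ 2
        else 2 * w.1.2 i * w.1.2 j),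
      ((4 * w.1.2 i / (m - 1) : ℝ) : ℂ) * w.2)

/-- The matrix `E_{k,l}`. -/
def E {n : ℕ} (k l : Idx n) : Matrix (Idx n) (Idx n) ℝ := Matrix.single k l 1

/-- The element of the Lie algebra `sl(2,ℝ) ⊕ so(n+1,1)` of `G` that corresponds to a generator. -/
def Gen.alg {n : ℕ} : Gen n → Matrix (Fin 2) (Fin 2) ℝ × Matrix (Idx n) (Idx n) ℝ
  | X1 => (!![0, 1; 0, 0], 0)
  | X2 => (0, E (.inr 0) (.inr 1) + E (.inr 1) (.inr 0))
  | X3 => (!![-(1 / 2), 0; 0, 1 / 2], 0)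
  | Y i => (0, E (.inr 0) (.inl i) - E (.inl i) (.inr 0) +
      E (.inr 1) (.inl i) + E (.inl i) (.inr 1))
  | Z i j => (0, E (.inl j) (.inl i) - E (.inl i) (.inl j))
  | W i => (0, E (.inr 0) (.inl i) - E (.inl i) (.inr 0) -
      E (.inr 1) (.inl i) - E (.inl i) (.inr 1))

/-- Coefficients of a general element `∑ c_X X` of the symmetry algebra of `u_t = Δ(u^m)`. -/
def IsSymmetryCoeff {n : ℕ} (m : ℝ) (c : Gen n →₀ ℝ) : Prop :=
  ∀ X ∈ c.support, X.IsSymmetry m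

/-- The vector field `∑ c_X X`. -/
def symField {n : ℕ} (m : ℝ) (c : Gen n →₀ ℝ) : SpaceTime n × ℂ → SpaceTime n × ℂ :=
  Finsupp.linearCombination ℝ (Gen.field m) c

/-- The Lie algebra element that corresponds to `∑ c_X X`. -/
def symAlg {n : ℕ} (c : Gen n →₀ ℝ) : Matrix (Fin 2) (Fin 2) ℝ × Matrix (Idx n) (Idx n) ℝ :=
  Finsupp.linearCombination ℝ Gen.alg c

/-- `g = exp(ε A)` in `G`, where `A` is the Lie algebra element that corresponds to `∑ c_X X`. -/
def IsExp {n : ℕ} (c : Gen n →₀ ℝ) (ε : ℝ) (g : G n) : Prop :=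
  mat₁ g = NormedSpace.exp (ε • (symAlg c).1) ∧ mat₂ g = NormedSpace.exp (ε • (symAlg c).2)

/-- The symmetry group of `u_t = Δ(u^m)`, as the (connected Lie) subgroup of `G` that is generated
by the one-parameter groups of the symmetry algebra. -/
def symmetryGroup (n : ℕ) (m : ℝ) : Subgroup (G n) :=
  Subgroup.closure {g | ∃ (c : Gen n →₀ ℝ) (ε : ℝ), IsSymmetryCoeff m c ∧ IsExp c ε g}

/-- The time-`ε` map of the local flow of the vector field `v` on the space of `((t, x), u)` sends
the point `w` to the point `w'`. -/
def FlowsTo {n : ℕ} (v : SpaceTime n × ℂ → SpaceTime n × ℂ) (ε : ℝ) (w w' : SpaceTime n × ℂ) :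
    Prop :=
  ∃ γ : ℝ → SpaceTime n × ℂ,
    IsIntegralCurveOn γ (fun _ => v) (Set.uIcc 0 ε) ∧ γ 0 = w ∧ γ ε = w'

/-! ### Solutions of the equation `u_t = Δ(u^m)` -/

/-- `P` is an `m`-th power function: `P y = y^m` for `y > 0`, and `P (l y) = l^m P y` for all `y` and
all `l > 0`. (Off the positive half-line several conventions for `y^m` are in use, such as
`|y|^{m-1} y`, or the principal branch.) -/
def IsPower (m : ℝ) (P : ℂ → ℂ) : Prop :=
  (∀ y : ℝ, 0 < y → P y = ((y ^ m : ℝ) : ℂ)) ∧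
    ∀ (l : ℝ) (y : ℂ), 0 < l → P (l * y) = ((l ^ m : ℝ) : ℂ) * P y

/-- `u` is a classical solution of `u_t = Δ(u^m)` on `U`, where `P` is the `m`-th power function. -/
def IsSolutionOn {n : ℕ} (P : ℂ → ℂ) (u : SpaceTime n → ℂ) (U : Set (SpaceTime n)) : Prop :=
  ∀ z ∈ U, DifferentiableAt ℝ (fun t => u (t, z.2)) z.1 ∧
    ContDiffAt ℝ 2 (fun x => P (u (z.1, x))) z.2 ∧
    deriv (fun t => u (t, z.2)) z.1 = Laplacian.laplacian (fun x => P (u (z.1, x))) z.2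

/-- The image of `U` under the (partially defined) action of `g` on `ℝ^{1,n} ≅ N Q⁻ / Q⁻ ⊂ G / Q⁻`:
the set of all `z'` such that `g n_z ∈ n_{z'} Q⁻` for some `z ∈ U`. -/
def baseImage {n : ℕ} (g : G n) (U : Set (SpaceTime n)) : Set (SpaceTime n) :=
  {z' | ∃ z ∈ U, ∃ (q : G n) (k : QParam n), IsQMinus k q ∧ g * nPlus z = nPlus z' * q}

end PorousMedium

end

noncomputable section

namespace PorousMedium

/-! ### The group acting on `ℝ²` and on the light cone -/

/-! `Q⁻` is the stabilizer in `G` of the line of `e₂ = (0, 1)` in `ℝ²` and of the ray of the null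
vector `v = (0, -1, 1)` in the light cone. So an element `φ` of the induced picture is a function of
the pair `(g₁ e₂, g₂ v)`, homogeneous of degrees `r` and `s` under positive scalars
(`apply_of_proportional`). For `g = n_{t,x}` the pair is `((t, 1), cone x)`, and every statement
about `f` becomes linear algebra with these two vectors.

Injectivity: where the pair is a multiple of some `((t, 1), cone x)`, `φ` is determined by `f`; this
open cell is dense and `φ` is continuous (`restrict_injective`). The action on `I'` is then
transported from left translation.

Globalization: along an integral curve of a symmetry, `(t, 1)` and `cone x` solve `w' = A w` up to a
scalar multiple of `w`, and the same scalars govern `u' = (2/(m-1)) (κ₁ + κ₂) u`. Integration shows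
that both vectors move by `exp(εA)` up to factors `e^{-K₁}` and `e^{K₂}`, while `u` is multiplied by
`e^{2(K₁+K₂)/(m-1)}` (`FlowsTo.spec`). With `r = -2/(m-1)` and `s = 2/(m-1)` this is exactly the
homogeneity of `φ`.

Solutions: if `g n_z = n_{z'} q`, then `g` is a product of the translation by `z'`, a Levi element,
some `n⁻_{0,b}` and the translation by `-z`. The first `SL(2)` column of `q` has no lower entry
because all `SL(2)` parts in `S_m` are upper triangular. Translations are harmless, Levi elements
act by scalings and rotations (`solution_levi`), and `n⁻_{0,b}` acts by a special conformal map.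
Either `b = 0`, because without the `W_i` the point at infinity `(0, 1, 1)` is fixed projectively,
or `m = (n-2)/(n+2)`, which gives `s m = 1 - n/2`, the weight in the conformal covariance of the
Laplacian (`laplacian_comp_specialConformal`). All of this is needed only at the origin, a fixed
point of these maps. -/

/-- The null vector whose stabilizer in `SO(n+1,1)₀` is `SO(n) N⁻`. -/
def nullVec (n : ℕ) : Idx n → ℝ := Sum.elim 0 ![-1, 1]

/-- The point `(2x, ‖x‖² - 1, ‖x‖² + 1)` of the light cone. -/
def cone {n : ℕ} (x : Space n) : Idx n → ℝ :=
  Sum.elim (fun i => 2 * x i) ![‖x‖ ^ 2 - 1, ‖x‖ ^ 2 + 1]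

variable {n : ℕ}

@[simp] theorem mat₁_mul (g h : G n) : mat₁ (g * h) = mat₁ g * mat₁ h := rfl
@[simp] theorem mat₂_mul (g h : G n) : mat₂ (g * h) = mat₂ g * mat₂ h := rfl
@[simp] theorem mat₁_one : mat₁ (1 : G n) = 1 := rfl
@[simp] theorem mat₂_one : mat₂ (1 : G n) = 1 := rfl

theorem mat₁_inv_mul (g : G n) : mat₁ g⁻¹ * mat₁ g = 1 := by
  rw [← mat₁_mul, inv_mul_cancel, mat₁_one]

theorem mat₂_inv_mul (g : G n) : mat₂ g⁻¹ * mat₂ g = 1 := by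
  rw [← mat₂_mul, inv_mul_cancel, mat₂_one]

theorem ext_mat {g h : G n} (h₁ : mat₁ g = mat₁ h) (h₂ : mat₂ g = mat₂ h) : g = h :=
  Prod.ext (Subtype.ext h₁) (Subtype.ext (Subtype.ext h₂))

theorem mat₁_det (g : G n) : (mat₁ g).det = 1 := g.1.2

theorem mat₂_det (g : G n) : (mat₂ g).det = 1 := (g.2 : SpecialLinearGroup (Idx n) ℝ).2

theorem mat₂_form (g : G n) : (mat₂ g)ᵀ * form n * mat₂ g = form n := by
  obtain ⟨a, -, ha⟩ := g.2.2
  have h : (a : SpecialLinearGroup (Idx n) ℝ).1ᵀ * form n * (a : SpecialLinearGroup (Idx n) ℝ).1 =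
    form n := a.2
  have h2 : mat₂ g = (a : SpecialLinearGroup (Idx n) ℝ).1 := congrArg Subtype.val ha.symm
  rw [h2, h]

/-! ### `Q⁻` as the stabilizer of a line and a null ray; homogeneity of induced functions. -/

theorem norm_sq_eq_sum (x : Space n) : ‖x‖ ^ 2 = ∑ i, x i * x i := by
  rw [EuclideanSpace.real_norm_sq_eq]
  exact Finset.sum_congr rfl fun i _ => by ring

theorem form_entries {A : Matrix (Idx n) (Idx n) ℝ} (hA : Aᵀ * form n * A = form n) (k l : Idx n) :
    ∑ i, A (.inl i) k * A (.inl i) l + A (.inr 0) k * A (.inr 0) l - A (.inr 1) k * A (.inr 1) l =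
      form n k l := by
  rw [← hA]
  simp [Matrix.mul_apply, form, Fintype.sum_sum_type, Fin.sum_univ_two, Matrix.one_apply]
  ring

/-- Since `A` preserves the form `J`, the covector `vᵀ J` is a left eigenvector with the inverse
eigenvalue. It controls rows of `A` just as `v` controls columns. -/
theorem dual_eigenvector {A : Matrix (Idx n) (Idx n) ℝ} (hA : Aᵀ * form n * A = form n) {μ : ℝ}
    (hμ : μ ≠ 0) (h : A *ᵥ nullVec n = μ • nullVec n) :
    nullVec n ᵥ* form n ᵥ* A = μ⁻¹ • (nullVec n ᵥ* form n) := by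
  have h1 : μ • (nullVec n ᵥ* form n ᵥ* A) = nullVec n ᵥ* form n := by
    calc μ • (nullVec n ᵥ* form n ᵥ* A) = (μ • nullVec n) ᵥ* form n ᵥ* A := by
          simp [Matrix.smul_vecMul]
      _ = nullVec n ᵥ* (Aᵀ * form n * A) := by
          rw [← h, ← vecMul_transpose]; simp only [Matrix.vecMul_vecMul, Matrix.mul_assoc]
      _ = _ := by rw [hA]
  rw [eq_inv_smul_iff₀ hμ, h1]

theorem nMinusMat_eq_transpose (x : Space n) : nMinusMat x = (nPlusMat x)ᵀ := by
  rw [nPlusMat, nMinusMat, fromBlocks_transpose]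
  congr 1
  · simp
  · ext i j
    fin_cases j <;> simp
  · ext i j
    fin_cases i <;> simp
  · ext i j
    fin_cases i <;> fin_cases j <;> simp

/-- The right and left eigenvector equations tie the last two columns together and the last two rows
together. What remains free is the upper left block `B` and the last row, and the relations `AᵀJA =
J` make `B` orthogonal and fix all other entries. The hyperbolic parameter is `-log μ` because `h_y`
scales the null vector by `e^{-y}`. -/
theorem exists_decomposition {A : Matrix (Idx n) (Idx n) ℝ} (hA : Aᵀ * form n * A = form n)
    (hdet : A.det = 1) {μ : ℝ} (hμ : 0 < μ) (h : A *ᵥ nullVec n = μ • nullVec n) :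
    ∃ (B : Matrix.specialOrthogonalGroup (Fin n) ℝ) (x : Space n),
      A = mMat (B : Matrix (Fin n) (Fin n) ℝ) * hMat n (-Real.log μ) * nMinusMat x := by
  have hd := dual_eigenvector hA hμ.ne' h
  have h1 : ∀ k, A k (.inr 1) = A k (.inr 0) + μ * nullVec n k := fun k => by
    have := congrFun h k
    simp [Matrix.mulVec, dotProduct, nullVec, Fintype.sum_sum_type] at this
    simp [nullVec]
    linarith
  have h2 : ∀ k, A (.inr 0) k = - A (.inr 1) k + μ⁻¹ * Sum.elim (0 : Fin n → ℝ) (1 : Fin 2 → ℝ) k := fun k => by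
    have := congrFun hd k
    rcases k with k | k
    · simp [Matrix.vecMul, dotProduct, nullVec, form, Fintype.sum_sum_type] at this
      simp
      linarith
    · fin_cases k <;>
      · simp [Matrix.vecMul, dotProduct, nullVec, form, Fintype.sum_sum_type] at this
        simp
        linarith
  have hf := form_entries hA
  set B : Matrix (Fin n) (Fin n) ℝ := A.toBlocks₁₁ with hBdef
  have hB : Bᵀ * B = 1 := by
    ext i j
    have := hf (.inl i) (.inl j)
    -- Rows `n+1` and `n+2` are opposite in these columns, so their contributions to the form cancel
    -- and only `BᵀB` is left.
    rw [h2 (.inl i), h2 (.inl j)] at this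
    simp [form, Matrix.one_apply] at this
    simp [Matrix.mul_apply, hBdef, toBlocks₁₁, Matrix.one_apply, this]
  have hB' : B * Bᵀ = 1 := mul_eq_one_comm.mp hB
  let x : Space n := WithLp.toLp 2 fun i => μ⁻¹ * A (.inr 1) (.inl i)
  have hx : ∀ i, x i = μ⁻¹ * A (.inr 1) (.inl i) := fun i => rfl
  let u : Fin n → ℝ := fun i => A (.inl i) (.inr 0)
  have hu : Bᵀ *ᵥ u = x.ofLp := by
    ext i
    have := hf (.inl i) (.inr 0)
    rw [h2 (.inl i), h2 (.inr 0)] at this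
    simp [form] at this
    simp [Matrix.mulVec, dotProduct, u, hBdef, toBlocks₁₁, hx]
    linarith
  have hu' : ∀ i, A (.inl i) (.inr 0) = ∑ j, B i j * x j := fun i => by
    have : u = B *ᵥ x.ofLp := by rw [← hu, Matrix.mulVec_mulVec, hB', Matrix.one_mulVec]
    exact congrFun this i
  have hnorm : ∑ i, A (.inl i) (.inr 0) * A (.inl i) (.inr 0) = ‖x‖ ^ 2 := by
    rw [norm_sq_eq_sum]
    change u ⬝ᵥ u = x.ofLp ⬝ᵥ x.ofLp
    rw [← hu, Matrix.dotProduct_mulVec, Matrix.vecMul_transpose, Matrix.mulVec_mulVec, hB',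
      Matrix.one_mulVec]
  have h00 := hf (.inr 0) (.inr 0)
  rw [hnorm, h2 (.inr 0)] at h00
  simp [form] at h00
  -- The last free entry comes from column `n+1` having form value `1`.
  have hA10 : A (.inr 1) (.inr 0) = μ⁻¹ / 2 - μ / 2 + μ * ‖x‖ ^ 2 / 2 := by
    field_simp at h00 ⊢
    linarith
  have hA00 := h2 (.inr 0)
  have hA01 := h1 (.inr 0)
  have hA11 := h1 (.inr 1)
  have key : A = mMat B * hMat n (-Real.log μ) * nMinusMat x := by
    rw [mMat, hMat, nMinusMat, fromBlocks_multiply, fromBlocks_multiply, ← fromBlocks_toBlocks A]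
    simp only [Real.cosh_neg, Real.sinh_neg, Real.cosh_log hμ, Real.sinh_log hμ]
    congr 1
    · simp [hBdef]
    · ext i j
      fin_cases j
      · simp [toBlocks₁₂, Matrix.mul_apply, hu']
      · simp [toBlocks₁₂, Matrix.mul_apply, hu', h1, nullVec]
    · ext i j
      fin_cases i
      · simp [toBlocks₂₁, h2 (.inl j), hx]
        field_simp
        ring
      · simp [toBlocks₂₁, hx]
        field_simp
        ring
    · ext i j
      fin_cases i <;> fin_cases j <;>
      · simp [toBlocks₂₂, nullVec] at hA00 hA01 hA11 ⊢
        simp only [hA11, hA01, hA00, hA10]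
        field_simp
        ring
  have hdetB : B.det = 1 := by
    have hN : (nMinusMat x).det = 1 := by
      rw [nMinusMat_eq_transpose, det_transpose, nPlusMat_det]
    have hH : (hMat n (-Real.log μ)).det = 1 := by
      rw [hMat, det_fromBlocks_one₁₁, det_fin_two]
      simp
      linarith [Real.cosh_sq (Real.log μ), Real.cosh_sq (Real.log μ)]
    have := hdet
    rw [key, det_mul, det_mul, hN, hH, mMat, det_fromBlocks_zero₁₂] at this
    simpa using this
  refine ⟨⟨B, ?_⟩, x, key⟩
  rw [Matrix.mem_specialOrthogonalGroup_iff]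
  exact ⟨by rw [Matrix.mem_orthogonalGroup_iff']; exact hB, hdetB⟩

/-- In the `SL(2)` factor the matrix is lower triangular with diagonal `l⁻¹, l`; the sign of `l` is
absorbed by `j` and its modulus by `a = |l|⁻¹`. -/
theorem exists_isQMinus (q : G n) {l μ : ℝ} (hl : l ≠ 0) (hμ : 0 < μ)
    (h₁ : mat₁ q *ᵥ ![0, 1] = l • ![0, 1]) (h₂ : mat₂ q *ᵥ nullVec n = μ • nullVec n) :
    ∃ k : QParam n, IsQMinus k q ∧ k.a = |l|⁻¹ ∧ k.y = -Real.log μ ∧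
      k.j = if 0 < l then 0 else 1 := by
  obtain ⟨B, x, hx⟩ := exists_decomposition (mat₂_form q) (mat₂_det q) hμ h₂
  have h01 : mat₁ q 0 1 = 0 := by simpa [Matrix.mulVec, dotProduct] using congrFun h₁ 0
  have h11 : mat₁ q 1 1 = l := by simpa [Matrix.mulVec, dotProduct] using congrFun h₁ 1
  have hd := mat₁_det q
  rw [det_fin_two, h01, h11] at hd
  have h00 : mat₁ q 0 0 = l⁻¹ := by field_simp; linarith
  have hq : mat₁ q = !![l⁻¹, 0; mat₁ q 1 0, l] := by
    ext i j
    fin_cases i <;> fin_cases j <;> simp [h00, h01, h11]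
  refine ⟨⟨if 0 < l then 0 else 1, B, |l|⁻¹, by positivity, -Real.log μ, mat₁ q 1 0 / l, x⟩,
    ⟨?_, hx⟩, rfl, rfl, rfl⟩
  change mat₁ q = !![-1, 0; 0, -1] ^ (if 0 < l then (0 : ZMod 2) else 1).val *
    !![|l|⁻¹, 0; 0, |l|⁻¹⁻¹] * !![1, 0; mat₁ q 1 0 / l, 1]
  generalize mat₁ q 1 0 = c at hq
  rw [hq]
  rcases lt_or_gt_of_ne hl with h | h
  · rw [if_neg h.not_gt, abs_of_neg h]
    have : (1 : ZMod 2).val = 1 := rfl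
    simp only [this, pow_one]
    ext i j
    fin_cases i <;> fin_cases j <;> simp [Matrix.mul_apply] <;> field_simp
  · rw [if_pos h, abs_of_pos h]
    simp only [ZMod.val_zero, pow_zero, one_mul]
    ext i j
    fin_cases i <;> fin_cases j <;> simp [Matrix.mul_apply] <;> field_simp

theorem exists_coset_of_proportional (g g' : G n) {l μ : ℝ} (hl : l ≠ 0) (hμ : 0 < μ)
    (h₁ : mat₁ g *ᵥ ![0, 1] = l • (mat₁ g' *ᵥ ![0, 1]))
    (h₂ : mat₂ g *ᵥ nullVec n = μ • (mat₂ g' *ᵥ nullVec n)) :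
    ∃ k : QParam n, IsQMinus k (g'⁻¹ * g) ∧ k.a = |l|⁻¹ ∧ k.y = -Real.log μ ∧
      k.j = if 0 < l then 0 else 1 := by
  refine exists_isQMinus (g'⁻¹ * g) hl hμ ?_ ?_
  · rw [mat₁_mul, ← Matrix.mulVec_mulVec, h₁, Matrix.mulVec_smul, Matrix.mulVec_mulVec,
      mat₁_inv_mul, Matrix.one_mulVec]
  · rw [mat₂_mul, ← Matrix.mulVec_mulVec, h₂, Matrix.mulVec_smul, Matrix.mulVec_mulVec,
      mat₂_inv_mul, Matrix.one_mulVec]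

/-- Elements of `Ind` are homogeneous functions of `(g₁ e₂, g₂ (e_{n+2} - e_{n+1}))`. -/
theorem apply_of_proportional {p : ZMod 2} {r s : ℝ} (φ : Ind n p r s) (g g' : G n) {l μ : ℝ}
    (hl : 0 < l) (hμ : 0 < μ)
    (h₁ : mat₁ g *ᵥ ![0, 1] = l • (mat₁ g' *ᵥ ![0, 1]))
    (h₂ : mat₂ g *ᵥ nullVec n = μ • (mat₂ g' *ᵥ nullVec n)) :
    φ.1 g = ((l ^ r * μ ^ s : ℝ) : ℂ) * φ.1 g' := by
  obtain ⟨k, hk, ha, hy, hj⟩ := exists_coset_of_proportional g g' hl.ne' hμ h₁ h₂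
  have := φ.2.2 g' (g'⁻¹ * g) k hk
  rw [mul_inv_cancel_left] at this
  rw [this, QParam.chi, ha, hy, hj, if_pos hl, abs_of_pos hl, ZMod.val_zero, zero_mul, pow_zero,
    one_mul, ← Complex.ofReal_cpow (by positivity), ← Complex.ofReal_mul, ← Complex.ofReal_exp,
    ← Complex.ofReal_mul, ← Complex.ofReal_inv, Real.inv_rpow hl.le, mul_inv, inv_inv,
    Real.rpow_def_of_pos hμ, ← Real.exp_neg]
  congr 4
  ring

/-- Vanishing does not see the value of the character, so here `l` may be negative and the exponents
complex. -/
theorem apply_eq_zero_of_proportional {p : ZMod 2} {r s : ℂ} (φ : Ind n p r s) (g g' : G n)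
    {l μ : ℝ} (hl : l ≠ 0) (hμ : 0 < μ)
    (h₁ : mat₁ g *ᵥ ![0, 1] = l • (mat₁ g' *ᵥ ![0, 1]))
    (h₂ : mat₂ g *ᵥ nullVec n = μ • (mat₂ g' *ᵥ nullVec n)) (h : φ.1 g' = 0) : φ.1 g = 0 := by
  obtain ⟨k, hk, -⟩ := exists_coset_of_proportional g g' hl hμ h₁ h₂
  have := φ.2.2 g' (g'⁻¹ * g) k hk
  rwa [mul_inv_cancel_left, h, mul_zero] at this

theorem mat₁_nPlus (z : SpaceTime n) : mat₁ (nPlus z) = !![1, z.1; 0, 1] := rfl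

theorem mat₂_nPlus (z : SpaceTime n) : mat₂ (nPlus z) = nPlusMat z.2 := rfl

theorem mat₁_nPlus_mulVec (z : SpaceTime n) : mat₁ (nPlus z) *ᵥ ![0, 1] = ![z.1, 1] := by
  ext i
  fin_cases i <;> simp [mat₁_nPlus, Matrix.mulVec, dotProduct]

theorem mat₂_nPlus_mulVec (z : SpaceTime n) : mat₂ (nPlus z) *ᵥ nullVec n = cone z.2 := by
  ext i
  rcases i with i | i
  · simp [mat₂_nPlus, Matrix.mulVec, dotProduct, nPlusMat, nullVec, cone, Fintype.sum_sum_type]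
    ring
  · fin_cases i <;>
    · simp [mat₂_nPlus, Matrix.mulVec, dotProduct, nPlusMat, nullVec, cone, Fintype.sum_sum_type]
      ring

/-! ### The light cone and its forward half. -/

/-- The quadratic form. -/
def quad (w : Idx n → ℝ) : ℝ :=
  ∑ i, w (.inl i) * w (.inl i) + w (.inr 0) * w (.inr 0) - w (.inr 1) * w (.inr 1)

theorem quad_eq (w : Idx n → ℝ) : quad w = w ⬝ᵥ (form n *ᵥ w) := by
  simp [quad, form, dotProduct, Matrix.mulVec, Fintype.sum_sum_type, Matrix.one_apply]
  ring

theorem quad_mulVec {A : Matrix (Idx n) (Idx n) ℝ} (hA : Aᵀ * form n * A = form n)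
    (w : Idx n → ℝ) : quad (A *ᵥ w) = quad w := by
  rw [quad_eq, quad_eq]
  nth_rw 2 [← hA]
  rw [← Matrix.mulVec_mulVec, ← Matrix.mulVec_mulVec, Matrix.dotProduct_mulVec w,
    Matrix.vecMul_transpose]

theorem quad_nullVec : quad (nullVec n) = 0 := by
  simp [quad, nullVec]

theorem eq_zero_of_quad {w : Idx n → ℝ} (hw : quad w = 0) (h : w (.inr 1) = 0) : w = 0 := by
  rw [quad, h] at hw
  have h1 : ∀ i ∈ Finset.univ, 0 ≤ w (.inl i) * w (.inl i) := fun i _ => mul_self_nonneg _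
  have h2 := Finset.sum_nonneg h1
  have h3 := mul_self_nonneg (w (.inr 0))
  have h4 : ∑ i, w (.inl i) * w (.inl i) = 0 := by linarith
  rw [Finset.sum_eq_zero_iff_of_nonneg h1] at h4
  ext k
  rcases k with k | k
  · simpa using h4 k (Finset.mem_univ k)
  · fin_cases k
    · simpa using (by linarith : w (.inr 0) * w (.inr 0) = 0)
    · exact h

theorem mulVec_ne_zero {ι : Type*} [Fintype ι] [DecidableEq ι] {A : Matrix ι ι ℝ} (hA : A.det = 1)
    {w : ι → ℝ} (hw : w ≠ 0) : A *ᵥ w ≠ 0 := by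
  intro h
  exact hw (Matrix.eq_zero_of_mulVec_eq_zero (by rw [hA]; exact one_ne_zero) h)

theorem nullVec_ne_zero : nullVec n ≠ 0 := fun h => by
  simpa [nullVec] using congrFun h (.inr 1)

/-- A nonzero null vector has nonzero last coordinate, so the sign of that coordinate is constant on
the identity component. Thus scalars on the light cone are always positive and only those on `ℝ²`
can change sign. -/
theorem mat₂_mulVec_nullVec_pos (g : G n) : 0 < (mat₂ g *ᵥ nullVec n) (.inr 1) := by
  obtain ⟨a, ha, hag⟩ := g.2.2
  have hmat : mat₂ g = (a : SpecialLinearGroup (Idx n) ℝ).1 := congrArg Subtype.val hag.symm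
  rw [hmat]
  let F : SOnOne n → ℝ := fun b => ((b : SpecialLinearGroup (Idx n) ℝ).1 *ᵥ nullVec n) (.inr 1)
  have hF : Continuous F := by
    have : Continuous fun b : SOnOne n => (b : SpecialLinearGroup (Idx n) ℝ).1 :=
      continuous_subtype_val.comp continuous_subtype_val
    exact continuous_pi_iff.mp (this.matrix_mulVec continuous_const) _
  have hne : ∀ b, F b ≠ 0 := fun b hb =>
    mulVec_ne_zero (b : SpecialLinearGroup (Idx n) ℝ).2 nullVec_ne_zero
      (eq_zero_of_quad ((quad_mulVec b.2 _).trans quad_nullVec) hb)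
  have h1 : F 1 = 1 := by simp [F, nullVec]
  by_contra hcon
  have hpre : IsPreconnected (connectedComponent (1 : SOnOne n)) :=
    isPreconnected_connectedComponent
  have := hpre.intermediate_value ha mem_connectedComponent hF.continuousOn
    (show (0 : ℝ) ∈ Set.Icc (F a) (F 1) from ⟨not_lt.mp hcon, by rw [h1]; norm_num⟩)
  obtain ⟨b, -, hb⟩ := this
  exact hne b hb

/-! ### Smoothness and injectivity of the restriction map -/

theorem continuous_SOnOneId_mk {X : Type*} [TopologicalSpace X] {F : X → SOnOne n}
    (hF : Continuous F) (h : ∀ x, (F x : SpecialLinearGroup (Idx n) ℝ) ∈ SOnOneId n) :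
    Continuous fun x => (⟨F x, h x⟩ : SOnOneId n) :=
  Continuous.subtype_mk (continuous_subtype_val.comp hF) _

theorem mem_SOnOneId_of_path {X : Type*} [TopologicalSpace X] [PreconnectedSpace X]
    {F : X → SOnOne n} (hF : Continuous F) {x₀ : X} (h₀ : F x₀ = 1) (x : X) :
    (F x : SpecialLinearGroup (Idx n) ℝ) ∈ SOnOneId n :=
  ⟨F x, (isPreconnected_range hF).subset_connectedComponent (x := (1 : SOnOne n)) ⟨x₀, h₀⟩
    ⟨x, rfl⟩, rfl⟩

theorem continuous_nPlus : Continuous (nPlus : SpaceTime n → G n) := by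
  refine Continuous.prodMk ?_ ?_
  · refine Continuous.subtype_mk (continuous_matrix fun i j => ?_) _
    fin_cases i <;> fin_cases j <;> simp <;> fun_prop
  · exact continuous_SOnOneId_mk ((continuous_nPlusSO n).comp continuous_snd) fun z => nPlusSO_mem _

theorem contDiff_restrict {φ : G n → ℂ} (hφ : IsSmooth φ) :
    ContDiff ℝ ∞ fun z => φ (nPlus z) := by
  rw [contDiff_iff_contDiffAt]
  intro z
  obtain ⟨F, hF, hF'⟩ := hφ (nPlus z)
  have h1 : ContDiff ℝ ∞ fun z : SpaceTime n =>
      ((fun i j => mat₁ (nPlus z) i j, fun i j => mat₂ (nPlus z) i j) :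
        (Fin 2 → Fin 2 → ℝ) × (Idx n → Idx n → ℝ)) := by
    have hn : ContDiff ℝ ∞ fun z : SpaceTime n => ‖z.2‖ ^ 2 := contDiff_snd.norm_sq ℝ
    have hc : ∀ i, ContDiff ℝ ∞ fun z : SpaceTime n => z.2 i := fun i => by fun_prop
    refine ContDiff.prodMk ?_ ?_
    · refine contDiff_pi.2 fun i => contDiff_pi.2 fun j => ?_
      fin_cases i <;> fin_cases j <;> simp [mat₁_nPlus] <;> fun_prop
    · refine contDiff_pi.2 fun i => contDiff_pi.2 fun j => ?_
      rcases i with i | i <;> rcases j with j | j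
      · simp only [mat₂_nPlus, nPlusMat, fromBlocks_apply₁₁]
        fun_prop
      · fin_cases j <;> simp [mat₂_nPlus, nPlusMat] <;> fun_prop
      · simp only [mat₂_nPlus, nPlusMat, fromBlocks_apply₂₁, of_apply]
        fun_prop
      · fin_cases i <;> fin_cases j <;> simp [mat₂_nPlus, nPlusMat] <;> fun_prop
  refine (hF.comp h1).contDiffAt.congr_of_eventuallyEq ?_
  exact continuous_nPlus.continuousAt.eventually hF'

theorem IsSmooth.continuous {φ : G n → ℂ} (hφ : IsSmooth φ) : Continuous φ := by
  rw [continuous_iff_continuousAt]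
  intro g
  obtain ⟨F, hF, hF'⟩ := hφ g
  refine ContinuousAt.congr ?_ (hF'.mono fun _ h => h.symm)
  have hfst : Continuous fun g : G n => g.1 := continuous_fst
  have hsnd : Continuous fun g : G n => g.2 := continuous_snd
  have h₁ : Continuous (mat₁ : G n → Matrix (Fin 2) (Fin 2) ℝ) := hfst.subtype_val
  have h₂ : Continuous (mat₂ : G n → Matrix (Idx n) (Idx n) ℝ) := hsnd.subtype_val.subtype_val
  exact (hF.continuous.comp (h₁.prodMk h₂)).continuousAt

/-- `n⁻_x` as an element of `SO(n+1,1)`. -/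
def nMinusSO (x : Space n) : SOnOne n :=
  ⟨⟨nMinusMat x, by rw [nMinusMat_eq_transpose, det_transpose, nPlusMat_det]⟩, by
    have hJ : form n * form n = 1 := by
      rw [form, fromBlocks_multiply]
      simp [← Matrix.one_fin_two]
    have h := nPlusMat_form x
    -- `J nᵀ J` is a left inverse of `n = nPlusMat x`, hence a right inverse, which says that the
    -- transpose preserves `J` too.
    have h1 : form n * (nPlusMat x)ᵀ * form n * nPlusMat x = 1 := by
      rw [Matrix.mul_assoc, Matrix.mul_assoc, ← Matrix.mul_assoc (nPlusMat x)ᵀ, h, hJ]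
    have h2 := mul_eq_one_comm.mp h1
    change (nMinusMat x)ᵀ * form n * nMinusMat x = form n
    rw [nMinusMat_eq_transpose, transpose_transpose]
    calc nPlusMat x * form n * (nPlusMat x)ᵀ
        = (nPlusMat x * (form n * (nPlusMat x)ᵀ * form n)) * form n := by
          simp only [Matrix.mul_assoc, hJ, Matrix.mul_one]
      _ = form n := by rw [h2, Matrix.one_mul]⟩

theorem continuous_nMinusSO : Continuous (nMinusSO : Space n → SOnOne n) := by
  refine Continuous.subtype_mk (Continuous.subtype_mk ?_ _) _
  have : Continuous fun x : Space n => nPlusMat x :=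
    Continuous.comp (g := fun a : SOnOne n => (a : SpecialLinearGroup (Idx n) ℝ).1)
      (continuous_subtype_val.comp continuous_subtype_val) (continuous_nPlusSO n)
  exact (continuous_congr fun x => nMinusMat_eq_transpose x).2 this.matrix_transpose

theorem nMinusMat_zero : nMinusMat (0 : Space n) = 1 := by
  have : nPlusMat (0 : Space n) = 1 :=
    congrArg (fun a : SOnOne n => (a : SpecialLinearGroup (Idx n) ℝ).1) (nPlusSO_zero n)
  rw [nMinusMat_eq_transpose, this, transpose_one]

theorem nMinusSO_zero : nMinusSO (0 : Space n) = 1 :=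
  Subtype.ext (Subtype.ext nMinusMat_zero)

/-- The element `n⁻_{t,x}` of `G`. -/
def nMinus (z : SpaceTime n) : G n :=
  (⟨!![1, 0; z.1, 1], by simp [det_fin_two]⟩,
    ⟨nMinusSO z.2, mem_SOnOneId_of_path continuous_nMinusSO nMinusSO_zero z.2⟩)

theorem mat₁_nMinus (z : SpaceTime n) : mat₁ (nMinus z) = !![1, 0; z.1, 1] := rfl

theorem mat₂_nMinus (z : SpaceTime n) : mat₂ (nMinus z) = nMinusMat z.2 := rfl

theorem continuous_nMinus : Continuous (nMinus : SpaceTime n → G n) := by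
  refine Continuous.prodMk ?_ ?_
  · refine Continuous.subtype_mk (continuous_matrix fun i j => ?_) _
    fin_cases i <;> fin_cases j <;> simp <;> fun_prop
  · exact continuous_SOnOneId_mk (continuous_nMinusSO.comp continuous_snd) _

theorem nMinus_zero : nMinus (0 : SpaceTime n) = 1 :=
  ext_mat (by simp [mat₁_nMinus, Matrix.one_fin_two]) nMinusMat_zero

theorem quad_mat₂_nullVec (g : G n) : quad (mat₂ g *ᵥ nullVec n) = 0 :=
  (quad_mulVec (mat₂_form g) _).trans quad_nullVec

/-- A vector of the light cone off the line of `(0, 1, 1)` is a multiple of some `cone x`. -/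
theorem exists_cone {w : Idx n → ℝ} (hw : quad w = 0) (h : w (.inr 0) ≠ w (.inr 1)) :
    ∃ x : Space n, w = ((w (.inr 1) - w (.inr 0)) / 2) • cone x := by
  have hne : w (.inr 1) - w (.inr 0) ≠ 0 := sub_ne_zero.2 h.symm
  let x : Space n := WithLp.toLp 2 fun i => w (.inl i) / (w (.inr 1) - w (.inr 0))
  have hx : ∀ i, x i = w (.inl i) / (w (.inr 1) - w (.inr 0)) := fun i => rfl
  have hn : ‖x‖ ^ 2 = (w (.inr 1) + w (.inr 0)) / (w (.inr 1) - w (.inr 0)) := by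
    rw [norm_sq_eq_sum, eq_div_iff hne]
    have h1 : ∀ i, x i * x i = w (.inl i) * w (.inl i) / (w (.inr 1) - w (.inr 0)) ^ 2 :=
      fun i => by rw [hx]; field_simp
    simp_rw [h1]
    rw [← Finset.sum_div]
    rw [quad] at hw
    rw [div_mul_eq_mul_div, div_eq_iff (pow_ne_zero 2 hne)]
    linear_combination (w (.inr 1) - w (.inr 0)) * hw
  refine ⟨x, ?_⟩
  ext k
  rcases k with k | k
  · simp [cone, hx]
    field_simp
  · fin_cases k <;> simp [cone, hn] <;> field_simp <;> ring

theorem le_of_quad {w : Idx n → ℝ} (hw : quad w = 0) (h : 0 < w (.inr 1)) :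
    w (.inr 0) ≤ w (.inr 1) := by
  rw [quad] at hw
  have h2 : 0 ≤ ∑ i, w (.inl i) * w (.inl i) := Finset.sum_nonneg fun i _ => mul_self_nonneg _
  nlinarith

/-- Density of the open cell in the form needed: a point outside it is the limit of its translates
by `n⁻_{ε z}` as `ε → 0`. -/
theorem eq_zero_of_perturbation {φ : G n → ℂ} (hφ : Continuous φ) (g : G n) (z : SpaceTime n)
    (h : ∀ ε : ℝ, ε ≠ 0 → φ (nMinus (ε • z) * g) = 0) : φ g = 0 := by
  have hc : Continuous fun ε : ℝ => φ (nMinus (ε • z) * g) :=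
    hφ.comp ((continuous_nMinus.comp (continuous_id.smul continuous_const)).mul continuous_const)
  have h0 : φ g = φ (nMinus ((0 : ℝ) • z) * g) := by rw [zero_smul, nMinus_zero, one_mul]
  rw [h0]
  have h1 : Filter.Tendsto (fun ε : ℝ => φ (nMinus (ε • z) * g)) (𝓝[≠] 0) (𝓝 0) :=
    tendsto_const_nhds.congr' (by
      filter_upwards [self_mem_nhdsWithin] with ε hε using (h ε hε).symm)
  exact tendsto_nhds_unique (hc.continuousAt.tendsto.mono_left nhdsWithin_le_nhds) h1

theorem restrict_injective (hn : 1 ≤ n) (p : ZMod 2) (r s : ℂ) :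
    Function.Injective (restrict n p r s) := by
  rw [← LinearMap.ker_eq_bot, LinearMap.ker_eq_bot']
  intro φ hφ
  have hφ0 : ∀ z, φ.1 (nPlus z) = 0 := fun z => congrFun hφ z
  have hc := φ.2.1.continuous
  -- on the open cell
  have h1 : ∀ g : G n, (mat₁ g *ᵥ ![0, 1]) 1 ≠ 0 →
      (mat₂ g *ᵥ nullVec n) (.inr 0) ≠ (mat₂ g *ᵥ nullVec n) (.inr 1) → φ.1 g = 0 := by
    intro g hg₁ hg₂
    have hq := quad_mat₂_nullVec g
    obtain ⟨x, hx⟩ := exists_cone hq hg₂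
    have hlt := lt_of_le_of_ne (le_of_quad hq (mat₂_mulVec_nullVec_pos g)) hg₂
    refine apply_eq_zero_of_proportional φ g
      (nPlus ((mat₁ g *ᵥ ![0, 1]) 0 / (mat₁ g *ᵥ ![0, 1]) 1, x)) hg₁
      (half_pos (sub_pos.2 hlt)) ?_ ?_ (hφ0 _)
    · rw [mat₁_nPlus_mulVec]
      ext i
      fin_cases i
      · simp only [Fin.zero_eta, Pi.smul_apply, smul_eq_mul, Matrix.cons_val_zero]
        field_simp
      · simp
    · rw [mat₂_nPlus_mulVec]
      exact hx
  have h2 : ∀ g : G n, (mat₁ g *ᵥ ![0, 1]) 1 ≠ 0 → φ.1 g = 0 := by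
    intro g hg₁
    by_cases hg₂ : (mat₂ g *ᵥ nullVec n) (.inr 0) = (mat₂ g *ᵥ nullVec n) (.inr 1)
    swap
    · exact h1 g hg₁ hg₂
    have hq := quad_mat₂_nullVec g
    have hpos := mat₂_mulVec_nullVec_pos g
    set w := mat₂ g *ᵥ nullVec n with hwdef
    have hwl : ∀ i, w (.inl i) = 0 := by
      rw [quad, hg₂, add_sub_cancel_right,
        Finset.sum_eq_zero_iff_of_nonneg fun i _ => mul_self_nonneg _] at hq
      exact fun i => by simpa using hq i (Finset.mem_univ i)
    let i₀ : Fin n := ⟨0, hn⟩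
    -- Here `w` is a positive multiple `c` of `(0, 1, 1)`, and `n⁻_{ε e}` changes the difference of
    -- its last two coordinates from `0` to `-2 ε² c`, while the `SL(2)` factor stays put. A spatial
    -- direction `e` exists because `n ≥ 1`.
    refine eq_zero_of_perturbation hc g (0, EuclideanSpace.single i₀ 1) fun ε hε => h1 _ ?_ ?_
    · simpa [mat₁_nMinus, ← Matrix.one_fin_two] using hg₁
    · have hnorm : ‖ε • EuclideanSpace.single i₀ (1 : ℝ)‖ ^ 2 = ε ^ 2 := by
        rw [norm_smul]
        simp
      rw [mat₂_mul, ← Matrix.mulVec_mulVec, ← hwdef, mat₂_nMinus]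
      simp only [Prod.smul_mk, nMinusMat, hnorm, Matrix.mulVec, dotProduct, Fintype.sum_sum_type,
        Fin.sum_univ_two, hwl, hg₂, fromBlocks_apply₂₁, fromBlocks_apply₂₂]
      simp
      intro h
      have : ε ^ 2 * w (.inr 1) = 0 := by linarith
      simp [hε, hpos.ne'] at this
  ext g
  change φ.1 g = 0
  by_cases hg₁ : (mat₁ g *ᵥ ![0, 1]) 1 = 0
  swap
  · exact h2 g hg₁
  -- Now the `SL(2)` factor is perturbed: `(v₀, 0)` with `v₀ ≠ 0` goes to `(v₀, ε v₀)`.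
  refine eq_zero_of_perturbation hc g (1, 0) fun ε hε => h2 _ ?_
  have hne : mat₁ g *ᵥ ![0, 1] ≠ 0 := mulVec_ne_zero (mat₁_det g) fun h => by
    simpa using congrFun h 1
  rw [mat₁_mul, ← Matrix.mulVec_mulVec]
  generalize mat₁ g *ᵥ ![0, 1] = v at hg₁ hne
  have hv : v 0 ≠ 0 := fun h => hne (by ext i; fin_cases i; exacts [h, hg₁])
  simp [mat₁_nMinus, Matrix.mulVec, dotProduct, hg₁, hv, hε]

/-! ### The action on the non-compact picture -/

/-- The restriction map as an isomorphism onto `I'(p,r,s)`. -/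
def restrictEquiv (hn : 1 ≤ n) (p : ZMod 2) (r s : ℂ) : Ind n p r s ≃ₗ[ℂ] I' n p r s :=
  LinearEquiv.ofInjective (restrict n p r s) (restrict_injective hn p r s)

/-- The action of `G` on `I'(p,r,s)` that corresponds to left translation. -/
def action (hn : 1 ≤ n) (p : ZMod 2) (r s : ℂ) : Representation ℂ (G n) (I' n p r s) where
  toFun g := (restrictEquiv hn p r s).toLinearMap ∘ₗ leftTranslation n p r s g ∘ₗ
    (restrictEquiv hn p r s).symm.toLinearMap
  map_one' := by
    rw [map_one]
    exact LinearMap.ext fun f => (restrictEquiv hn p r s).apply_symm_apply f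
  map_mul' g h := by
    rw [map_mul]
    refine LinearMap.ext fun f => ?_
    simp only [LinearMap.comp_apply, LinearEquiv.coe_coe, Module.End.mul_apply,
      LinearEquiv.symm_apply_apply]

theorem action_restrict (hn : 1 ≤ n) (p : ZMod 2) (r s : ℂ) (g : G n) (φ : Ind n p r s) :
    action hn p r s g ((restrict n p r s).rangeRestrict φ) =
      (restrict n p r s).rangeRestrict (leftTranslation n p r s g φ) := by
  have h : ∀ ψ, (restrict n p r s).rangeRestrict ψ = restrictEquiv hn p r s ψ :=
    fun ψ => Subtype.ext rfl
  rw [h, h]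
  change restrictEquiv hn p r s (leftTranslation n p r s g
    ((restrictEquiv hn p r s).symm (restrictEquiv hn p r s φ))) = _
  rw [LinearEquiv.symm_apply_apply]

/-! ### One-parameter groups -/

section Exp

variable {ι : Type*} [Fintype ι] [DecidableEq ι]

attribute [local instance] Matrix.linftyOpNormedRing Matrix.linftyOpNormedAlgebra in
theorem hasDerivAt_exp_smul_apply (A : Matrix ι ι ℝ) (τ : ℝ) (i j : ι) :
    HasDerivAt (fun τ : ℝ => NormedSpace.exp (τ • A) i j) ((NormedSpace.exp (τ • A) * A) i j) τ := by
  have h := hasDerivAt_exp_smul_const (𝕂 := ℝ) A τ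
  let L : Matrix ι ι ℝ →L[ℝ] ℝ := (Matrix.entryLinearMap ℝ ℝ i j).toContinuousLinearMap
  exact L.hasFDerivAt.comp_hasDerivAt τ h

theorem continuous_exp_smul (A : Matrix ι ι ℝ) :
    Continuous fun τ : ℝ => NormedSpace.exp (τ • A) :=
  continuous_matrix fun i j => continuous_iff_continuousAt.2 fun τ =>
    (hasDerivAt_exp_smul_apply A τ i j).continuousAt

theorem exp_mul_exp_neg (A : Matrix ι ι ℝ) :
    NormedSpace.exp A * NormedSpace.exp (-A) = 1 := by
  rw [Matrix.exp_neg, Matrix.mul_nonsing_inv]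
  exact (Matrix.isUnit_iff_isUnit_det _).1 (Matrix.isUnit_exp A)

theorem eq_of_hasDerivWithinAt_zero {ε : ℝ} {f : ℝ → ℝ}
    (hf : ∀ τ ∈ Set.uIcc 0 ε, HasDerivWithinAt f 0 (Set.uIcc 0 ε) τ) : f ε = f 0 := by
  have := (convex_uIcc 0 ε).norm_image_sub_le_of_norm_hasDerivWithin_le (C := 0) hf
    (fun _ _ => by simp) Set.left_mem_uIcc Set.right_mem_uIcc
  simpa [sub_eq_zero] using this

theorem exists_primitive {ε : ℝ} {κ : ℝ → ℝ} (hκ : ContinuousOn κ (Set.uIcc 0 ε)) :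
    ∃ K : ℝ → ℝ, K 0 = 0 ∧
      ∀ τ ∈ Set.uIcc 0 ε, HasDerivWithinAt K (κ τ) (Set.uIcc 0 ε) τ := by
  -- `κ` is continuous only on the interval; its constant extension beyond the endpoints is
  -- continuous everywhere and can be integrated.
  let κ' : ℝ → ℝ := Set.IccExtend (min_le_max (a := (0 : ℝ)) (b := ε)) (Set.domRestrict _ κ)
  have hc : Continuous κ' := (continuousOn_iff_continuous_domRestrict.1 hκ).Icc_extend'
  refine ⟨fun τ => ∫ σ in (0 : ℝ)..τ, κ' σ, by simp, fun τ hτ => ?_⟩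
  have h1 : κ' τ = κ τ := Set.IccExtend_of_mem (min_le_max (a := (0 : ℝ)) (b := ε)) _ hτ
  rw [← h1]
  exact (hc.integral_hasStrictDerivAt 0 τ).hasDerivAt.hasDerivWithinAt

theorem eq_exp_mul_of_linear_ode {ε : ℝ} {κ K y : ℝ → ℝ} (hK0 : K 0 = 0)
    (hK : ∀ τ ∈ Set.uIcc 0 ε, HasDerivWithinAt K (κ τ) (Set.uIcc 0 ε) τ)
    (hy : ∀ τ ∈ Set.uIcc 0 ε, HasDerivWithinAt y (κ τ * y τ) (Set.uIcc 0 ε) τ) :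
    y ε = Real.exp (K ε) * y 0 := by
  have h := eq_of_hasDerivWithinAt_zero (ε := ε) (f := fun τ => Real.exp (-K τ) * y τ) fun τ hτ => by
    refine HasDerivWithinAt.congr_deriv ((hK τ hτ).neg.exp.mul (hy τ hτ)) ?_
    simp only [Pi.neg_apply]
    ring
  simp only [hK0, neg_zero, Real.exp_zero, one_mul] at h
  rw [← h, ← mul_assoc, ← Real.exp_add, add_neg_cancel, Real.exp_zero, one_mul]

/-- The curve `exp(-τA) w(τ)` satisfies `y' = κ y` in each coordinate, so it is only rescaled, by
`e^K`. The term `κ w` is the projective freedom in choosing representatives of a line or ray. -/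
theorem eq_exp_smul_mulVec_of_ode {ε : ℝ} {κ K : ℝ → ℝ} (A : Matrix ι ι ℝ) {w : ℝ → ι → ℝ}
    (hK0 : K 0 = 0) (hK : ∀ τ ∈ Set.uIcc 0 ε, HasDerivWithinAt K (κ τ) (Set.uIcc 0 ε) τ)
    (hw : ∀ τ ∈ Set.uIcc 0 ε, ∀ i,
      HasDerivWithinAt (fun τ => w τ i) ((A *ᵥ w τ) i + κ τ * w τ i) (Set.uIcc 0 ε) τ) :
    w ε = Real.exp (K ε) • (NormedSpace.exp (ε • A) *ᵥ w 0) := by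
  have h : NormedSpace.exp (ε • -A) *ᵥ w ε = Real.exp (K ε) • w 0 := by
    ext i
    have h1 := eq_exp_mul_of_linear_ode (ε := ε) (y := fun τ => (NormedSpace.exp (τ • -A) *ᵥ w τ) i)
      hK0 hK fun τ hτ => by
        have h2 : HasDerivWithinAt (fun τ => ∑ j, NormedSpace.exp (τ • -A) i j * w τ j)
            (∑ j, ((NormedSpace.exp (τ • -A) * -A) i j * w τ j +
              NormedSpace.exp (τ • -A) i j * ((A *ᵥ w τ) j + κ τ * w τ j))) (Set.uIcc 0 ε) τ :=
          HasDerivWithinAt.fun_sum fun j _ =>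
            (hasDerivAt_exp_smul_apply (-A) τ i j).hasDerivWithinAt.mul (hw τ hτ j)
        have h3 : (NormedSpace.exp (τ • -A) * -A) *ᵥ w τ + NormedSpace.exp (τ • -A) *ᵥ
            (A *ᵥ w τ + κ τ • w τ) = κ τ • (NormedSpace.exp (τ • -A) *ᵥ w τ) := by
          rw [Matrix.mulVec_add, Matrix.mulVec_mulVec, Matrix.mulVec_smul, Matrix.mul_neg,
            Matrix.neg_mulVec, neg_add_cancel_left]
        rw [Finset.sum_add_distrib] at h2
        exact h2.congr_deriv (congrFun h3 i)
    simpa using h1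
  have h4 : NormedSpace.exp (ε • A) *ᵥ (NormedSpace.exp (ε • -A) *ᵥ w ε) = w ε := by
    rw [Matrix.mulVec_mulVec, smul_neg, exp_mul_exp_neg, Matrix.one_mulVec]
  rw [← h4, h, Matrix.mulVec_smul]

theorem exp_smul_mulVec_of_eigenvector (A : Matrix ι ι ℝ) {v : ι → ℝ} {c : ℝ} (h : A *ᵥ v = c • v)
    (ε : ℝ) : NormedSpace.exp (ε • A) *ᵥ v = Real.exp (ε * c) • v := by
  -- The constant curve `v` solves `w' = A w - c w`, so no power series is needed.
  have := eq_exp_smul_mulVec_of_ode (ε := ε) (κ := fun _ => -c) (K := fun τ => τ * -c)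
    (w := fun _ => v) A (by simp)
    (fun τ _ => by simpa using ((hasDerivAt_id τ).mul_const (-c)).hasDerivWithinAt)
    (fun τ _ i => by simpa [h] using hasDerivWithinAt_const τ (Set.uIcc 0 ε) (v i))
  conv_rhs => rw [this]
  rw [smul_smul, ← Real.exp_add]
  simp

theorem exp_preserves {A J : Matrix ι ι ℝ} (hJ : IsUnit J) (h : Aᵀ * J + J * A = 0) :
    (NormedSpace.exp A)ᵀ * J * NormedSpace.exp A = J := by
  have hdet := (Matrix.isUnit_iff_isUnit_det _).1 hJ
  have h1 : J * A * J⁻¹ = -Aᵀ := by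
    rw [← neg_eq_of_add_eq_zero_right h, Matrix.neg_mul, Matrix.mul_assoc,
      Matrix.mul_nonsing_inv _ hdet, Matrix.mul_one]
  have h2 : J * NormedSpace.exp A = NormedSpace.exp (-Aᵀ) * J := by
    rw [← h1, Matrix.exp_conj _ _ hJ, Matrix.mul_assoc, Matrix.nonsing_inv_mul _ hdet,
      Matrix.mul_one]
  rw [← Matrix.exp_transpose, Matrix.mul_assoc, h2, ← Matrix.mul_assoc, exp_mul_exp_neg,
    Matrix.one_mul]

/-- Preservation of `J` gives only `det² = 1`. Applied to `A/2`, this suffices, since `exp A` is the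
square of `exp(A/2)`. -/
theorem det_exp_eq_one {A J : Matrix ι ι ℝ} (hJ : IsUnit J) (h : Aᵀ * J + J * A = 0) :
    (NormedSpace.exp A).det = 1 := by
  have h2 : NormedSpace.exp A =
      NormedSpace.exp ((1 / 2 : ℝ) • A) * NormedSpace.exp ((1 / 2 : ℝ) • A) := by
    rw [← Matrix.exp_add_of_commute _ _ (Commute.refl _), ← add_smul]
    norm_num
  have h3 := congrArg Matrix.det (exp_preserves (A := (1 / 2 : ℝ) • A) hJ (by
    rw [Matrix.transpose_smul, Matrix.smul_mul, Matrix.mul_smul, ← smul_add, h, smul_zero]))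
  have hdet := ((Matrix.isUnit_iff_isUnit_det _).1 hJ).ne_zero
  rw [Matrix.det_mul, Matrix.det_mul, Matrix.det_transpose] at h3
  rw [h2, Matrix.det_mul]
  exact mul_right_cancel₀ hdet (by linarith)

end Exp

theorem isUnit_form : IsUnit (form n) := by
  have hJ : form n * form n = 1 := by
    rw [form, fromBlocks_multiply]
    simp [← Matrix.one_fin_two]
  exact IsUnit.of_mul_eq_one _ hJ

theorem form_entry (k l : Idx n) :
    form n k l = if k = l then (if k = .inr 1 then -1 else 1) else 0 := by
  rcases k with k | k <;> rcases l with l | l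
  · simp [form, Matrix.one_apply]
  · simp [form]
  · simp [form]
  · fin_cases k <;> fin_cases l <;> simp [form]

theorem E_form (k l : Idx n) : E k l * form n = (if l = .inr 1 then -1 else 1 : ℝ) • E k l := by
  have : form n = Matrix.diagonal fun k => if k = .inr 1 then -1 else 1 := by
    ext i j
    rw [form_entry, Matrix.diagonal_apply]
  ext i j
  rw [this, Matrix.mul_diagonal, E, Matrix.smul_apply, smul_eq_mul, mul_comm, Matrix.single_apply]
  by_cases h : k = i ∧ l = j
  · simp [h]
  · simp [h]

theorem form_E (k l : Idx n) : form n * E k l = (if k = .inr 1 then -1 else 1 : ℝ) • E k l := by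
  have : form n = Matrix.diagonal fun k => if k = .inr 1 then -1 else 1 := by
    ext i j
    rw [form_entry, Matrix.diagonal_apply]
  ext i j
  rw [this, Matrix.diagonal_mul, E, Matrix.smul_apply, smul_eq_mul, Matrix.single_apply]
  by_cases h : k = i ∧ l = j
  · simp [h]
  · simp [h]

theorem E_transpose (k l : Idx n) : (E k l)ᵀ = E l k := Matrix.transpose_single _ _ _

theorem alg_snd_mem (X : Gen n) : X.alg.2ᵀ * form n + form n * X.alg.2 = 0 := by
  cases X <;>
    simp [Gen.alg, E_transpose, Matrix.add_mul, Matrix.mul_add, Matrix.sub_mul, Matrix.mul_sub,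
      E_form, form_E]
  all_goals abel

theorem symAlg_snd_mem (c : Gen n →₀ ℝ) :
    (symAlg c).2ᵀ * form n + form n * (symAlg c).2 = 0 := by
  induction c using Finsupp.induction_linear with
  | zero => simp [symAlg]
  | add f g hf hg =>
    have : symAlg (f + g) = symAlg f + symAlg g := map_add _ _ _
    rw [this, Prod.snd_add, Matrix.transpose_add, Matrix.add_mul, Matrix.mul_add,
      add_add_add_comm, hf, hg, add_zero]
  | single X a =>
    have : symAlg (Finsupp.single X a) = a • X.alg := by simp [symAlg]
    rw [this, Prod.smul_snd, Matrix.transpose_smul, Matrix.smul_mul, Matrix.mul_smul, ← smul_add,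
      alg_snd_mem, smul_zero]

theorem symAlg_fst (c : Gen n →₀ ℝ) :
    ∃ α β : ℝ, (symAlg c).1 = !![α, β; 0, -α] := by
  induction c using Finsupp.induction_linear with
  | zero => exact ⟨0, 0, by ext i j; fin_cases i <;> fin_cases j <;> simp [symAlg]⟩
  | add f g hf hg =>
    obtain ⟨a, b, h⟩ := hf
    obtain ⟨a', b', h'⟩ := hg
    have : symAlg (f + g) = symAlg f + symAlg g := map_add _ _ _
    refine ⟨a + a', b + b', ?_⟩
    rw [this, Prod.fst_add, h, h']
    ext i j
    fin_cases i <;> fin_cases j <;> simp [add_comm]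
  | single X a =>
    have : symAlg (Finsupp.single X a) = a • X.alg := by simp [symAlg]
    rw [this]
    cases X
    case X1 => exact ⟨0, a, by ext i j; fin_cases i <;> fin_cases j <;> simp [Gen.alg]⟩
    case X3 => exact ⟨-(a / 2), 0, by
      ext i j; fin_cases i <;> fin_cases j <;> simp [Gen.alg] <;> ring⟩
    all_goals exact ⟨0, 0, by ext i j; fin_cases i <;> fin_cases j <;> simp [Gen.alg]⟩

theorem exists_isExp (c : Gen n →₀ ℝ) (ε : ℝ) : ∃ g : G n, IsExp c ε g := by
  have hA : ∀ τ : ℝ, (τ • (symAlg c).2)ᵀ * form n + form n * (τ • (symAlg c).2) = 0 := fun τ => by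
    rw [Matrix.transpose_smul, Matrix.smul_mul, Matrix.mul_smul, ← smul_add, symAlg_snd_mem,
      smul_zero]
  -- The whole one-parameter group is kept as a curve through `1`, which places `exp(εA)` in the
  -- identity component.
  let F : ℝ → SOnOne n := fun τ => ⟨⟨NormedSpace.exp (τ • (symAlg c).2),
    det_exp_eq_one isUnit_form (hA τ)⟩, exp_preserves isUnit_form (hA τ)⟩
  have hF : Continuous F :=
    Continuous.subtype_mk (Continuous.subtype_mk (continuous_exp_smul _) _) _
  have hF0 : F 0 = 1 := by
    refine Subtype.ext (Subtype.ext ?_)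
    change NormedSpace.exp ((0 : ℝ) • (symAlg c).2) = 1
    rw [zero_smul, NormedSpace.exp_zero]
  -- The standard symplectic form: `sl(2)` is its Lie algebra, so the lemma on determinants used for
  -- `SO(n+1,1)` applies here as well.
  have hJ : IsUnit !![(0 : ℝ), 1; -1, 0] := by
    rw [Matrix.isUnit_iff_isUnit_det, det_fin_two]
    simp
  have hA' : (ε • (symAlg c).1)ᵀ * !![0, 1; -1, 0] + !![0, 1; -1, 0] * (ε • (symAlg c).1) = 0 := by
    obtain ⟨α, β, h⟩ := symAlg_fst c
    rw [h]
    ext i j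
    fin_cases i <;> fin_cases j <;> simp [Matrix.mul_apply]
  exact ⟨(⟨NormedSpace.exp (ε • (symAlg c).1), det_exp_eq_one hJ hA'⟩,
    ⟨F ε, mem_SOnOneId_of_path hF hF0 ε⟩), rfl, rfl⟩

/-! ### The local flow of the symmetry algebra -/

/-- The derivative of `cone` at `x` in direction `ξ`. -/
def coneDeriv (x ξ : Space n) : Idx n → ℝ :=
  Sum.elim (fun i => 2 * ξ i) fun _ => 2 * inner ℝ x ξ

/-- The infinitesimal multiplier of a generator on `ℝ²`. -/
def Gen.multiplier₁ : Gen n → ℝ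
  | X3 => 1 / 2
  | _ => 0

/-- The infinitesimal multiplier of a generator on the light cone. -/
def Gen.multiplier₂ (x : Space n) : Gen n → ℝ
  | X2 => 1
  | W i => 2 * x i
  | _ => 0

/-- `A (t, 1)` need not be tangent to the slice with second coordinate `1`. The multiplier times
`(t, 1)` is what has to be subtracted; only `X3` needs it. -/
theorem alg_fst_mulVec (m : ℝ) (X : Gen n) (w : SpaceTime n × ℂ) :
    ![(X.field m w).1.1, 0] = X.alg.1 *ᵥ ![w.1.1, 1] + (-X.multiplier₁) • ![w.1.1, 1] := by
  cases X <;> ext i <;> fin_cases i <;>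
    simp [Gen.field, Gen.alg, Gen.multiplier₁]
  ring

theorem E_mulVec (k l : Idx n) (w : Idx n → ℝ) : E k l *ᵥ w = Pi.single k (w l) := by
  rw [E, Matrix.single_mulVec]
  ext i
  simp [Function.update_apply, Pi.single_apply]

theorem field_W_eq (m : ℝ) (i : Fin n) (w : SpaceTime n × ℂ) :
    ((Gen.W i).field m w).1.2 =
      (2 * w.1.2 i) • w.1.2 - (‖w.1.2‖ ^ 2) • EuclideanSpace.single i 1 := by
  ext j
  rw [norm_sq_eq_sum, ← Finset.add_sum_erase _ _ (Finset.mem_univ i)]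
  simp only [Gen.field, PiLp.sub_apply, PiLp.smul_apply, smul_eq_mul, PiLp.single_apply]
  split_ifs with h
  · subst h
    simp only [← pow_two]
    ring
  · ring

/-- The same correction on the light cone, with the opposite sign convention: here the multiplier is
added. The two conventions match the opposite signs of `r` and `s`. -/
theorem alg_snd_mulVec (m : ℝ) (X : Gen n) (w : SpaceTime n × ℂ) :
    coneDeriv w.1.2 (X.field m w).1.2 =
      X.alg.2 *ᵥ cone w.1.2 + X.multiplier₂ w.1.2 • cone w.1.2 := by
  obtain ⟨⟨t, x⟩, u⟩ := w
  cases X with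
  | X1 => ext k; rcases k with k | k <;> simp [Gen.field, Gen.alg, Gen.multiplier₂, coneDeriv]
  | X2 =>
    ext k
    rcases k with k | k
    · simp [Gen.field, Gen.alg, Gen.multiplier₂, coneDeriv, cone, Matrix.add_mulVec, E_mulVec]
    · fin_cases k <;>
      · simp [Gen.field, Gen.alg, Gen.multiplier₂, coneDeriv, cone, Matrix.add_mulVec, E_mulVec]
        ring
  | X3 => ext k; rcases k with k | k <;> simp [Gen.field, Gen.alg, Gen.multiplier₂, coneDeriv]
  | Y i =>
    ext k
    rcases k with k | k
    · simp [Gen.field, Gen.alg, Gen.multiplier₂, coneDeriv, cone, Matrix.add_mulVec,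
        Matrix.sub_mulVec, E_mulVec, Pi.single_apply]
      split_ifs <;> ring
    · fin_cases k <;>
      simp [Gen.field, Gen.alg, Gen.multiplier₂, coneDeriv, cone, Matrix.add_mulVec,
        Matrix.sub_mulVec, E_mulVec, EuclideanSpace.inner_single_right]
  | Z i j =>
    ext k
    rcases k with k | k
    · simp [Gen.field, Gen.alg, Gen.multiplier₂, coneDeriv, cone,
        Matrix.sub_mulVec, E_mulVec, Pi.single_apply]
      split_ifs <;> ring
    · simp [Gen.field, Gen.alg, Gen.multiplier₂, coneDeriv,
        Matrix.sub_mulVec, E_mulVec, EuclideanSpace.inner_single_right, inner_sub_right]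
      ring
  | W i =>
    rw [field_W_eq]
    ext k
    rcases k with k | k
    · simp [Gen.alg, Gen.multiplier₂, coneDeriv, cone,
        Matrix.sub_mulVec, E_mulVec, Pi.single_apply]
      split_ifs <;> ring
    · fin_cases k <;>
      · simp [Gen.alg, Gen.multiplier₂, coneDeriv, cone,
          Matrix.sub_mulVec, E_mulVec, EuclideanSpace.inner_single_right, inner_sub_right,
          inner_smul_right]
        ring

theorem field_snd (m : ℝ) (X : Gen n) (w : SpaceTime n × ℂ) :
    (X.field m w).2 =
      ((2 / (m - 1) * (X.multiplier₁ + X.multiplier₂ w.1.2) : ℝ) : ℂ) * w.2 := by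
  cases X <;> simp [Gen.field, Gen.multiplier₁, Gen.multiplier₂]
  · left; ring
  · left; ring

/-- The infinitesimal multiplier of a general element of the symmetry algebra on `ℝ²`. -/
def symMultiplier₁ (c : Gen n →₀ ℝ) : ℝ := Finsupp.linearCombination ℝ Gen.multiplier₁ c

/-- The infinitesimal multiplier of a general element of the symmetry algebra on the light cone. -/
def symMultiplier₂ (c : Gen n →₀ ℝ) (x : Space n) : ℝ :=
  Finsupp.linearCombination ℝ (Gen.multiplier₂ x) c

theorem continuous_symMultiplier₂ (c : Gen n →₀ ℝ) : Continuous (symMultiplier₂ c) := by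
  unfold symMultiplier₂
  simp only [Finsupp.linearCombination_apply, Finsupp.sum, smul_eq_mul]
  refine continuous_finsetSum _ fun X _ => continuous_const.mul ?_
  cases X <;> simp only [Gen.multiplier₂] <;> fun_prop

theorem coneDeriv_add (x ξ η : Space n) :
    coneDeriv x (ξ + η) = coneDeriv x ξ + coneDeriv x η := by
  ext k
  rcases k with k | k
  · simp [coneDeriv, mul_add]
  · simp [coneDeriv, mul_add, inner_add_right]

theorem coneDeriv_smul (x ξ : Space n) (a : ℝ) :
    coneDeriv x (a • ξ) = a • coneDeriv x ξ := by
  ext k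
  rcases k with k | k
  · simp [coneDeriv, mul_left_comm]
  · simp [coneDeriv, mul_left_comm, inner_smul_right]

/-- All three identities are linear in the coefficients, so the generators suffice. The point is
that one pair of multipliers occurs in all of them. -/
theorem symField_spec (m : ℝ) (c : Gen n →₀ ℝ) (w : SpaceTime n × ℂ) :
    ![(symField m c w).1.1, 0] =
      (symAlg c).1 *ᵥ ![w.1.1, 1] + (-symMultiplier₁ c) • ![w.1.1, 1] ∧
    coneDeriv w.1.2 (symField m c w).1.2 =
      (symAlg c).2 *ᵥ cone w.1.2 + symMultiplier₂ c w.1.2 • cone w.1.2 ∧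
    (symField m c w).2 =
      ((2 / (m - 1) * (symMultiplier₁ c + symMultiplier₂ c w.1.2) : ℝ) : ℂ) * w.2 := by
  induction c using Finsupp.induction_linear with
  | zero =>
    refine ⟨?_, ?_, ?_⟩
    · simp [symField, symAlg, symMultiplier₁]
    · ext k
      rcases k with k | k <;> simp [symField, symAlg, symMultiplier₂, coneDeriv]
    · simp [symField, symMultiplier₁, symMultiplier₂]
  | add f g hf hg =>
    have h1 : symAlg (f + g) = symAlg f + symAlg g := map_add _ _ _
    have h2 : symField m (f + g) w = symField m f w + symField m g w := by
      rw [← Pi.add_apply]; exact congrFun (map_add _ _ _) w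
    have h3 : symMultiplier₁ (f + g) = symMultiplier₁ f + symMultiplier₁ g := map_add _ _ _
    have h4 : symMultiplier₂ (f + g) w.1.2 = symMultiplier₂ f w.1.2 + symMultiplier₂ g w.1.2 :=
      map_add _ _ _
    rw [h1, h2, h3, h4]
    refine ⟨?_, ?_, ?_⟩
    · have : ![(symField m f w + symField m g w).1.1, 0] =
          ![(symField m f w).1.1, 0] + ![(symField m g w).1.1, 0] := by simp
      rw [this, hf.1, hg.1, Prod.fst_add, Matrix.add_mulVec]
      module
    · rw [Prod.fst_add, Prod.snd_add, coneDeriv_add, hf.2.1, hg.2.1, Prod.snd_add,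
        Matrix.add_mulVec]
      module
    · rw [Prod.snd_add, hf.2.2, hg.2.2]
      push_cast
      ring
  | single X a =>
    have h1 : symAlg (Finsupp.single X a) = a • X.alg := by simp [symAlg]
    have h2 : symField m (Finsupp.single X a) w = a • X.field m w := by simp [symField]
    have h3 : symMultiplier₁ (Finsupp.single X a) = a * X.multiplier₁ := by simp [symMultiplier₁]
    have h4 : symMultiplier₂ (Finsupp.single X a) w.1.2 = a * X.multiplier₂ w.1.2 := by
      simp [symMultiplier₂]
    rw [h1, h2, h3, h4]
    refine ⟨?_, ?_, ?_⟩
    · have : ![(a • X.field m w).1.1, 0] = a • ![(X.field m w).1.1, 0] := by simp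
      rw [this, alg_fst_mulVec, Prod.smul_fst, Matrix.smul_mulVec]
      module
    · rw [Prod.smul_fst, Prod.smul_snd, coneDeriv_smul, alg_snd_mulVec, Prod.smul_snd,
        Matrix.smul_mulVec]
      module
    · rw [Prod.smul_snd, field_snd, Complex.real_smul]
      push_cast
      ring

theorem hasDerivWithinAt_cone {x : ℝ → Space n} {ξ : Space n} {I : Set ℝ} {τ : ℝ}
    (hx : HasDerivWithinAt x ξ I τ) (k : Idx n) :
    HasDerivWithinAt (fun τ => cone (x τ) k) (coneDeriv (x τ) ξ k) I τ := by
  have h1 : ∀ i, HasDerivWithinAt (fun τ => x τ i) (ξ i) I τ := fun i =>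
    (EuclideanSpace.proj (𝕜 := ℝ) i).hasFDerivAt.comp_hasDerivWithinAt τ hx
  have h2 := hx.norm_sq
  rcases k with k | k
  · exact (h1 k).const_mul 2
  · fin_cases k
    · exact h2.sub_const 1
    · exact h2.add_const 1

/-- Along the flow the pair `((t, 1), cone x)` moves by `exp(ε A)` up to scalars, and these scalars
determine how `u` changes. -/
theorem FlowsTo.spec {m : ℝ} {c : Gen n →₀ ℝ} {ε : ℝ} {w w' : SpaceTime n × ℂ}
    (h : FlowsTo (symField m c) ε w w') : ∃ K₁ K₂ : ℝ,
      ![w'.1.1, 1] = Real.exp (-K₁) • (NormedSpace.exp (ε • (symAlg c).1) *ᵥ ![w.1.1, 1]) ∧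
      cone w'.1.2 = Real.exp K₂ • (NormedSpace.exp (ε • (symAlg c).2) *ᵥ cone w.1.2) ∧
      w'.2 = (Real.exp (2 / (m - 1) * (K₁ + K₂)) : ℂ) * w.2 := by
  obtain ⟨γ, hγ, rfl, rfl⟩ := h
  have hγ' : ∀ τ ∈ Set.uIcc 0 ε, HasDerivWithinAt γ (symField m c (γ τ)) (Set.uIcc 0 ε) τ := hγ
  have hfst : ∀ τ ∈ Set.uIcc 0 ε,
      HasDerivWithinAt (fun τ => (γ τ).1) (symField m c (γ τ)).1 (Set.uIcc 0 ε) τ := fun τ hτ =>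
    (ContinuousLinearMap.fst ℝ (SpaceTime n) ℂ).hasFDerivAt.comp_hasDerivWithinAt τ (hγ' τ hτ)
  have ht : ∀ τ ∈ Set.uIcc 0 ε,
      HasDerivWithinAt (fun τ => (γ τ).1.1) (symField m c (γ τ)).1.1 (Set.uIcc 0 ε) τ :=
    fun τ hτ =>
      (ContinuousLinearMap.fst ℝ ℝ (Space n)).hasFDerivAt.comp_hasDerivWithinAt τ (hfst τ hτ)
  have hx : ∀ τ ∈ Set.uIcc 0 ε,
      HasDerivWithinAt (fun τ => (γ τ).1.2) (symField m c (γ τ)).1.2 (Set.uIcc 0 ε) τ :=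
    fun τ hτ =>
      (ContinuousLinearMap.snd ℝ ℝ (Space n)).hasFDerivAt.comp_hasDerivWithinAt τ (hfst τ hτ)
  have hu : ∀ τ ∈ Set.uIcc 0 ε,
      HasDerivWithinAt (fun τ => (γ τ).2) (symField m c (γ τ)).2 (Set.uIcc 0 ε) τ := fun τ hτ =>
    (ContinuousLinearMap.snd ℝ (SpaceTime n) ℂ).hasFDerivAt.comp_hasDerivWithinAt τ (hγ' τ hτ)
  have hκ : ContinuousOn (fun τ => symMultiplier₂ c (γ τ).1.2) (Set.uIcc 0 ε) :=
    (continuous_symMultiplier₂ c).comp_continuousOn fun τ hτ => (hx τ hτ).continuousWithinAt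
  obtain ⟨K, hK0, hK⟩ := exists_primitive hκ
  have hK₁ : ∀ τ : ℝ, HasDerivAt (fun τ => τ * symMultiplier₁ c) (symMultiplier₁ c) τ := fun τ => by
    simpa using (hasDerivAt_id τ).mul_const (symMultiplier₁ c)
  refine ⟨ε * symMultiplier₁ c, K ε, ?_, ?_, ?_⟩
  · refine eq_exp_smul_mulVec_of_ode (κ := fun _ => -symMultiplier₁ c)
      (K := fun τ => -(τ * symMultiplier₁ c)) (w := fun τ => ![(γ τ).1.1, 1]) _ (by simp)
      (fun τ _ => (hK₁ τ).neg.hasDerivWithinAt) fun τ hτ i => ?_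
    have h1 := congrFun (symField_spec m c (γ τ)).1 i
    refine HasDerivWithinAt.congr_deriv (f' := ![(symField m c (γ τ)).1.1, 0] i) ?_ h1
    fin_cases i
    · exact ht τ hτ
    · exact hasDerivWithinAt_const _ _ _
  · refine eq_exp_smul_mulVec_of_ode (w := fun τ => cone (γ τ).1.2) _ hK0 hK fun τ hτ i => ?_
    exact (hasDerivWithinAt_cone (hx τ hτ) i).congr_deriv
      (congrFun (symField_spec m c (γ τ)).2.1 i)
  · have hL : ∀ τ ∈ Set.uIcc 0 ε, HasDerivWithinAt
        (fun τ => 2 / (m - 1) * (τ * symMultiplier₁ c + K τ))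
        (2 / (m - 1) * (symMultiplier₁ c + symMultiplier₂ c (γ τ).1.2)) (Set.uIcc 0 ε) τ :=
      fun τ hτ => ((hK₁ τ).hasDerivWithinAt.add (hK τ hτ)).const_mul _
    have hL0 : 2 / (m - 1) * (0 * symMultiplier₁ c + K 0) = 0 := by simp [hK0]
    -- The coefficient of `u` is real, so real and imaginary parts satisfy the same scalar equation.
    have hre := eq_exp_mul_of_linear_ode (y := fun τ => (γ τ).2.re) hL0 hL fun τ hτ => by
      refine (Complex.reCLM.hasFDerivAt.comp_hasDerivWithinAt τ (hu τ hτ)).congr_deriv ?_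
      rw [(symField_spec m c (γ τ)).2.2]
      exact Complex.re_ofReal_mul _ _
    have him := eq_exp_mul_of_linear_ode (y := fun τ => (γ τ).2.im) hL0 hL fun τ hτ => by
      refine (Complex.imCLM.hasFDerivAt.comp_hasDerivWithinAt τ (hu τ hτ)).congr_deriv ?_
      rw [(symField_spec m c (γ τ)).2.2]
      exact Complex.im_ofReal_mul _ _
    refine Complex.ext ?_ ?_
    · rw [Complex.re_ofReal_mul]
      exact hre
    · rw [Complex.im_ofReal_mul]
      exact him

theorem apply_of_flowsTo {m : ℝ} {p : ZMod 2} {r s : ℝ} (hr : r = -2 / (m - 1))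
    (hs : s = 2 / (m - 1)) {c : Gen n →₀ ℝ} {ε : ℝ} {g : G n} (hg : IsExp c ε g)
    (φ : Ind n p r s) {z z' : SpaceTime n} {u' : ℂ}
    (h : FlowsTo (symField m c) ε (z, φ.1 (nPlus z)) (z', u')) :
    φ.1 (g⁻¹ * nPlus z') = u' := by
  obtain ⟨K₁, K₂, h1, h2, h3⟩ := h.spec
  dsimp only at h1 h2 h3
  rw [apply_of_proportional φ (g⁻¹ * nPlus z') (nPlus z) (Real.exp_pos (-K₁)) (Real.exp_pos K₂),
    h3, ← Real.exp_mul, ← Real.exp_mul, ← Real.exp_add]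
  -- Homogeneity gives the exponent `-K₁ r + K₂ s`, the flow gives `(2/(m-1)) (K₁ + K₂)`; here the
  -- values of `r` and `s` make them agree.
  · congr 3
    rw [hr, hs]
    ring
  · rw [mat₁_mul, ← Matrix.mulVec_mulVec, mat₁_nPlus_mulVec, mat₁_nPlus_mulVec, h1, ← hg.1,
      Matrix.mulVec_smul, Matrix.mulVec_mulVec, mat₁_inv_mul, Matrix.one_mulVec]
  · rw [mat₂_mul, ← Matrix.mulVec_mulVec, mat₂_nPlus_mulVec, mat₂_nPlus_mulVec, h2, ← hg.2,
      Matrix.mulVec_smul, Matrix.mulVec_mulVec, mat₂_inv_mul, Matrix.one_mulVec]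

/-! ### Second derivatives along curves and the Laplacian -/

section SecondDeriv

variable {E F : Type*} [NormedAddCommGroup E] [NormedSpace ℝ E] [NormedAddCommGroup F]
  [NormedSpace ℝ F]

/-- The curve `f` is differentiable near `0`, and its first two derivatives at `0` are `a` and `b`.
-/
def HasSecondDerivAtZero (f : ℝ → E) (a b : E) : Prop :=
  ∃ f' : ℝ → E, (∀ᶠ τ in 𝓝 0, HasDerivAt f (f' τ) τ) ∧ f' 0 = a ∧ HasDerivAt f' b 0

namespace HasSecondDerivAtZero

theorem hasDerivAt {f : ℝ → E} {a b : E} (h : HasSecondDerivAtZero f a b) : HasDerivAt f a 0 := by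
  obtain ⟨f', h1, rfl, -⟩ := h
  exact h1.self_of_nhds

/-- Lets a Laplacian be read off from second derivatives computed by any route, for instance by the
chain, product and power rules for curves that follow. -/
theorem unique {f : ℝ → E} {a b a' b' : E} (h : HasSecondDerivAtZero f a b)
    (h' : HasSecondDerivAtZero f a' b') : b = b' := by
  obtain ⟨f₁, h1, -, h2⟩ := h
  obtain ⟨f₂, h1', -, h2'⟩ := h'
  refine h2.unique (h2'.congr_of_eventuallyEq ?_)
  filter_upwards [h1, h1'] with τ h3 h4 using h3.unique h4

theorem congr {f g : ℝ → E} {a b : E} (h : HasSecondDerivAtZero f a b) (hfg : g =ᶠ[𝓝 0] f) :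
    HasSecondDerivAtZero g a b := by
  obtain ⟨f', h1, h2, h3⟩ := h
  refine ⟨f', ?_, h2, h3⟩
  filter_upwards [h1, hfg.eventuallyEq_nhds] with τ h4 h5 using h4.congr_of_eventuallyEq h5

theorem comp {c : ℝ → E} {h : E → F} {a b : E} (hc : HasSecondDerivAtZero c a b)
    (hh : ContDiffAt ℝ 2 h (c 0)) :
    HasSecondDerivAtZero (fun τ => h (c τ)) (fderiv ℝ h (c 0) a)
      (fderiv ℝ (fderiv ℝ h) (c 0) a a + fderiv ℝ h (c 0) b) := by
  have hc0 := hc.hasDerivAt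
  obtain ⟨c', h1, rfl, h2⟩ := hc
  refine ⟨fun τ => fderiv ℝ h (c τ) (c' τ), ?_, rfl, ?_⟩
  · have h3 : ∀ᶠ y in 𝓝 (c 0), DifferentiableAt ℝ h y := by
      filter_upwards [hh.eventually (by simp)] with y hy using hy.differentiableAt (by simp)
    filter_upwards [h1, hc0.continuousAt.eventually h3] with τ h4 h5
    exact h5.hasFDerivAt.comp_hasDerivAt τ h4
  · have h3 : HasFDerivAt (fderiv ℝ h) (fderiv ℝ (fderiv ℝ h) (c 0)) (c 0) :=
      ((hh.fderiv_right (m := 1) (by norm_num)).differentiableAt (by simp)).hasFDerivAt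
    exact (h3.comp_hasDerivAt 0 hc0).clm_apply h2

theorem smul {M : ℝ → ℝ} {f : ℝ → E} {a b : ℝ} {v w : E} (hM : HasSecondDerivAtZero M a b)
    (hf : HasSecondDerivAtZero f v w) :
    HasSecondDerivAtZero (fun τ => M τ • f τ) (M 0 • v + a • f 0)
      (M 0 • w + (2 * a) • v + b • f 0) := by
  have hM0 := hM.hasDerivAt
  have hf0 := hf.hasDerivAt
  obtain ⟨M', h1, rfl, h2⟩ := hM
  obtain ⟨f', h3, rfl, h4⟩ := hf
  refine ⟨fun τ => M τ • f' τ + M' τ • f τ, ?_, rfl, ?_⟩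
  · filter_upwards [h1, h3] with τ h5 h6 using h5.smul h6
  · exact ((hM0.smul h4).add (h2.smul hf0)).congr_deriv (by module)

theorem rpow {M : ℝ → ℝ} {a b : ℝ} (hM : HasSecondDerivAtZero M a b) (h1 : M 0 = 1) (α : ℝ) :
    HasSecondDerivAtZero (fun τ => M τ ^ α) (α * a) (α * b + α * (α - 1) * a ^ 2) := by
  have hM0 := hM.hasDerivAt
  have hpos : ∀ᶠ τ in 𝓝 0, 0 < M τ :=
    hM0.continuousAt.eventually (lt_mem_nhds (by rw [h1]; exact one_pos))
  obtain ⟨M', h2, rfl, h3⟩ := hM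
  refine ⟨fun τ => M' τ * α * M τ ^ (α - 1), ?_, by simp [h1, mul_comm], ?_⟩
  · filter_upwards [h2, hpos] with τ h4 h5 using h4.rpow_const (Or.inl h5.ne')
  · refine ((h3.mul_const α).mul (hM0.rpow_const (p := α - 1) (Or.inl (by simp [h1])))).congr_deriv
      ?_
    rw [h1]
    simp
    ring

theorem quadratic (x v w : E) :
    HasSecondDerivAtZero (fun τ => x + τ • v + τ ^ 2 • w) v ((2 : ℝ) • w) := by
  refine ⟨fun τ => v + (2 * τ) • w, Filter.Eventually.of_forall fun τ => ?_, by simp, ?_⟩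
  · have h1 := ((hasDerivAt_id τ).smul_const v).const_add x
    have h2 := ((hasDerivAt_id τ).pow 2).smul_const w
    refine (h1.add h2).congr_deriv ?_
    simp
  · have h1 := (((hasDerivAt_id (0 : ℝ)).const_mul 2).smul_const w).const_add v
    exact h1.congr_deriv (by simp)

theorem line (x v : E) : HasSecondDerivAtZero (fun τ : ℝ => x + τ • v) v 0 := by
  simpa using quadratic x v 0

end HasSecondDerivAtZero

end SecondDeriv

/-! ### The Laplacian under similarities and special conformal maps. -/

variable {F : Type*} [NormedAddCommGroup F] [NormedSpace ℝ F]

theorem laplacian_eq_sum (b : OrthonormalBasis (Fin n) ℝ (Space n)) (h : Space n → F)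
    (x : Space n) :
    Laplacian.laplacian h x = ∑ i, fderiv ℝ (fderiv ℝ h) x (b i) (b i) := by
  rw [InnerProductSpace.laplacian_eq_iteratedFDeriv_orthonormalBasis h b]
  simp [iteratedFDeriv_two_apply]

/-- The Laplacian is the sum of the second derivatives along the coordinate lines. -/
theorem laplacian_eq_sum_of_hasSecondDeriv {h : Space n → F} (hh : ContDiffAt ℝ 2 h 0)
    {a b : Fin n → F}
    (H : ∀ i, HasSecondDerivAtZero (fun τ : ℝ => h (τ • EuclideanSpace.single i 1)) (a i) (b i)) :
    Laplacian.laplacian h 0 = ∑ i, b i := by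
  rw [laplacian_eq_sum (EuclideanSpace.basisFun (Fin n) ℝ)]
  refine Finset.sum_congr rfl fun i _ => ?_
  have h1 := (HasSecondDerivAtZero.line (0 : Space n) (EuclideanSpace.single i 1)).comp (h := h)
    (by simpa using hh)
  simp only [zero_smul, add_zero, zero_add, map_zero] at h1
  rw [EuclideanSpace.basisFun_apply]
  exact h1.unique (H i)

theorem laplacian_comp_similarity {h : Space n → F} (hh : ContDiffAt ℝ 2 h 0)
    (R : Space n ≃ₗᵢ[ℝ] Space n) (c : ℝ) :
    ContDiffAt ℝ 2 (fun x => h (c • R x)) 0 ∧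
      Laplacian.laplacian (fun x => h (c • R x)) 0 = c ^ 2 • Laplacian.laplacian h 0 := by
  have h0 : c • R 0 = 0 := by simp
  have hC : ContDiffAt ℝ 2 (fun x => h (c • R x)) 0 := by
    refine ContDiffAt.comp (g := h) 0 (by rwa [h0]) ?_
    exact (R.toContinuousLinearEquiv.contDiff.const_smul c).contDiffAt
  refine ⟨hC, ?_⟩
  -- In the rotated orthonormal basis for `h`, the two sums agree term by term up to the factor
  -- `c²`.
  rw [laplacian_eq_sum ((EuclideanSpace.basisFun (Fin n) ℝ).map R) h, Finset.smul_sum]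
  refine laplacian_eq_sum_of_hasSecondDeriv hC
    (a := fun i => fderiv ℝ h 0 (c • R (EuclideanSpace.single i 1))) fun i => ?_
  have h1 := (HasSecondDerivAtZero.line (0 : Space n) (c • R (EuclideanSpace.single i 1))).comp
    (h := h) (by simpa using hh)
  simp only [zero_smul, add_zero, zero_add, map_zero] at h1
  simp only [OrthonormalBasis.map_apply, EuclideanSpace.basisFun_apply, map_smul] at h1 ⊢
  simp only [smul_comm _ c, _root_.smul_apply, smul_smul, ← pow_two] at h1 ⊢
  exact h1

/-- The conformal factor of the special conformal transformation with parameter `b`. -/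
def conformalFactor (b x : Space n) : ℝ := 1 + 2 * inner ℝ b x + ‖b‖ ^ 2 * ‖x‖ ^ 2

/-- The special conformal transformation with parameter `b`. -/
def specialConformal (b x : Space n) : Space n := (conformalFactor b x)⁻¹ • (x + ‖x‖ ^ 2 • b)

theorem conformalFactor_zero (b : Space n) : conformalFactor b 0 = 1 := by simp [conformalFactor]

theorem specialConformal_zero (b : Space n) : specialConformal b 0 = 0 := by
  simp [specialConformal]

theorem contDiff_conformalFactor (b : Space n) : ContDiff ℝ 2 (conformalFactor b) := by
  have h1 : ContDiff ℝ 2 fun x : Space n => ‖x‖ ^ 2 := contDiff_id.norm_sq ℝ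
  have h2 : ContDiff ℝ 2 fun x : Space n => inner ℝ b x := contDiff_const.inner ℝ contDiff_id
  exact (contDiff_const.add (contDiff_const.mul h2)).add (contDiff_const.mul h1)

theorem eventually_conformalFactor_pos (b : Space n) : ∀ᶠ x in 𝓝 0, 0 < conformalFactor b x :=
  (contDiff_conformalFactor b).continuous.continuousAt.eventually
    (lt_mem_nhds (by rw [conformalFactor_zero]; exact one_pos))

/-- The conformal covariance of the Laplacian, at a fixed point of a special conformal
transformation. -/
theorem laplacian_comp_specialConformal {h : Space n → F} (hh : ContDiffAt ℝ 2 h 0)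
    (b : Space n) {α : ℝ} (hα : α = 1 - n / 2) :
    ContDiffAt ℝ 2 (fun x => conformalFactor b x ^ α • h (specialConformal b x)) 0 ∧
      Laplacian.laplacian (fun x => conformalFactor b x ^ α • h (specialConformal b x)) 0 =
        Laplacian.laplacian h 0 := by
  have hμ := (contDiff_conformalFactor b).contDiffAt (x := 0)
  have hne : conformalFactor b 0 ≠ 0 := by rw [conformalFactor_zero]; exact one_ne_zero
  have hC : ContDiffAt ℝ 2 (fun x => conformalFactor b x ^ α • h (specialConformal b x)) 0 := by
    have h1 : ContDiff ℝ 2 fun x : Space n => ‖x‖ ^ 2 := contDiff_id.norm_sq ℝ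
    refine (hμ.rpow_const_of_ne hne).smul
      (ContDiffAt.comp (g := h) 0 (by rwa [specialConformal_zero]) ?_)
    exact (hμ.inv hne).smul (contDiff_id.add (h1.smul contDiff_const)).contDiffAt
  refine ⟨hC, ?_⟩
  have hline : ∀ (i : Fin n) (τ : ℝ), conformalFactor b (τ • EuclideanSpace.single i 1) =
      1 + τ • (2 * b i) + τ ^ 2 • ‖b‖ ^ 2 := fun i τ => by
    simp [conformalFactor, inner_smul_right, EuclideanSpace.inner_single_right, norm_smul]
    ring
  have hsecond : ∀ i, HasSecondDerivAtZero
      (fun τ : ℝ => conformalFactor b (τ • EuclideanSpace.single i 1) ^ α •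
        h (specialConformal b (τ • EuclideanSpace.single i 1)))
      (fderiv ℝ h 0 (EuclideanSpace.single i 1) + (2 * α * b i) • h 0)
      (fderiv ℝ (fderiv ℝ h) 0 (EuclideanSpace.single i 1) (EuclideanSpace.single i 1) +
        (4 * (α - 1)) • b i • fderiv ℝ h 0 (EuclideanSpace.single i 1) +
        (2 : ℝ) • fderiv ℝ h 0 b +
        (2 * α * ‖b‖ ^ 2 + 4 * α * (α - 1) * (b i * b i)) • h 0) := fun i => by
    have hM : HasSecondDerivAtZero (fun τ : ℝ => conformalFactor b (τ • EuclideanSpace.single i 1))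
        (2 * b i) ((2 : ℝ) • ‖b‖ ^ 2) := by
      simp only [hline]
      exact HasSecondDerivAtZero.quadratic _ _ _
    have hM0 : conformalFactor b ((0 : ℝ) • EuclideanSpace.single i 1) = 1 := by
      rw [zero_smul, conformalFactor_zero]
    have hψ : HasSecondDerivAtZero
        (fun τ : ℝ => specialConformal b (τ • EuclideanSpace.single i 1)) _ _ :=
      -- On the line `τ eᵢ` the map is `σ⁻¹ (τ eᵢ + τ² b)` with `σ` quadratic in `τ`, since `‖τ eᵢ‖²
      -- = τ²`.
      ((hM.rpow hM0 (-1)).smul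
        (HasSecondDerivAtZero.quadratic 0 (EuclideanSpace.single i 1) b)).congr (by
          refine Filter.Eventually.of_forall fun τ => ?_
          simp [specialConformal, Real.rpow_neg_one, norm_smul])
    have hψ0 : specialConformal b ((0 : ℝ) • EuclideanSpace.single i 1) = 0 := by
      rw [zero_smul, specialConformal_zero]
    have hF := (hM.rpow hM0 α).smul (hψ.comp (h := h) (by rwa [hψ0]))
    simp only [hM0, hψ0] at hF
    simp only [zero_smul, Real.one_rpow, one_smul, add_zero, smul_zero, ne_eq,
      OfNat.ofNat_ne_zero, not_false_eq_true, zero_pow, map_add, map_smul] at hF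
    convert hF using 1
    · module
    · simp only [smul_eq_mul]
      module
  rw [laplacian_eq_sum_of_hasSecondDeriv hC hsecond,
    laplacian_eq_sum (EuclideanSpace.basisFun (Fin n) ℝ) h]
  have hsum : ∑ i, b i • fderiv ℝ h 0 (EuclideanSpace.single i 1) = fderiv ℝ h 0 b := by
    conv_rhs => rw [← (EuclideanSpace.basisFun (Fin n) ℝ).sum_repr b]
    simp
  simp only [EuclideanSpace.basisFun_apply, Finset.sum_add_distrib, ← Finset.sum_smul,
    ← Finset.smul_sum, ← Finset.mul_sum, ← norm_sq_eq_sum, hsum, Finset.sum_const,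
    Finset.card_univ, Fintype.card_fin, nsmul_eq_mul]
  -- Summed over `i`, the coefficient of `Dh(b)` is `4(α-1) + 2n` and that of `‖b‖² h(0)` is `2αn +
  -- 4α(α-1)`; both vanish for `α = 1 - n/2`.
  rw [hα]
  module

/-! ### Solutions at a point -/

/-- `u` is a classical solution of `u_t = Δ(u^m)` at the point `z`. -/
def IsSolutionAt (P : ℂ → ℂ) (u : SpaceTime n → ℂ) (z : SpaceTime n) : Prop :=
  DifferentiableAt ℝ (fun t => u (t, z.2)) z.1 ∧
    ContDiffAt ℝ 2 (fun x => P (u (z.1, x))) z.2 ∧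
    deriv (fun t => u (t, z.2)) z.1 = Laplacian.laplacian (fun x => P (u (z.1, x))) z.2

theorem IsSolutionAt.comp_add {P : ℂ → ℂ} {u v : SpaceTime n → ℂ} {z w : SpaceTime n}
    (h : IsSolutionAt P u (z + w)) (hv : ∀ y, v y = u (y + w)) : IsSolutionAt P v z := by
  obtain ⟨h1, h2, h3⟩ := h
  have hu : ∀ t x, v (t, x) = u (t + w.1, x + w.2) := fun t x => hv (t, x)
  refine ⟨?_, ?_, ?_⟩
  · simp only [hu]
    exact DifferentiableAt.comp (g := fun t => u (t, z.2 + w.2)) z.1 h1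
      (differentiableAt_id.add_const w.1)
  · simp only [hu]
    exact ContDiffAt.comp (g := fun x => P (u (z.1 + w.1, x))) z.2 h2
      (contDiffAt_id.add contDiffAt_const)
  · simp only [hu]
    rw [deriv_comp_add_const (f := fun t => u (t, z.2 + w.2))]
    rw [laplacian_eq_sum (EuclideanSpace.basisFun (Fin n) ℝ)]
    have h4 : fderiv ℝ (fun x => P (u (z.1 + w.1, x + w.2))) =
        fun x => fderiv ℝ (fun x => P (u (z.1 + w.1, x))) (x + w.2) :=
      funext fun x => fderiv_comp_add_right (f := fun x => P (u (z.1 + w.1, x))) w.2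
    rw [h4, fderiv_comp_add_right (f := fderiv ℝ fun x => P (u (z.1 + w.1, x))) w.2,
      ← laplacian_eq_sum]
    exact h3

/-- Scaling symmetries of the equation, combined with rotations. -/
theorem IsSolutionAt.comp_similarity {m : ℝ} {P : ℂ → ℂ} (hP : IsPower m P)
    {u v : SpaceTime n → ℂ} (h : IsSolutionAt P u 0) (R : Space n ≃ₗᵢ[ℝ] Space n) {C a c : ℝ}
    (hC : 0 < C) (hCa : C * a = C ^ m * c ^ 2)
    (hv : ∀ t x, v (t, x) = (C : ℂ) * u (a * t, c • R x)) : IsSolutionAt P v 0 := by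
  obtain ⟨h1, h2, h3⟩ := h
  simp only [Prod.fst_zero, Prod.snd_zero] at h1 h2 h3
  have hat : HasDerivAt (fun t : ℝ => a * t) a 0 := by
    simpa using (hasDerivAt_id (0 : ℝ)).const_mul a
  have hd : HasDerivAt (fun t => v (t, 0)) ((C : ℂ) * (a • deriv (fun t => u (t, 0)) 0)) 0 := by
    have h4 : HasDerivAt (fun t => u (t, 0)) (deriv (fun t => u (t, 0)) 0) (a * 0) := by
      rw [mul_zero]
      exact h1.hasDerivAt
    simp only [hv, map_zero, smul_zero]
    exact (h4.scomp 0 hat).const_mul (C : ℂ)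
  -- Homogeneity of `P` is all that is used about the power. The equation then scales by `C a` on
  -- the left and by `C^m c²` on the right.
  have hPv : (fun x => P (v (0, x))) = (C ^ m) • fun x => P (u (0, c • R x)) := by
    funext x
    rw [hv, mul_zero, hP.2 C _ hC, Pi.smul_apply, Complex.real_smul]
  obtain ⟨h5, h6⟩ := laplacian_comp_similarity h2 R c
  refine ⟨hd.differentiableAt, ?_, ?_⟩
  · rw [Prod.fst_zero, hPv]
    exact (contDiffAt_const (c := C ^ m)).smul h5
  · rw [Prod.fst_zero, Prod.snd_zero, hPv, InnerProductSpace.laplacian_smul _ h5, h6, hd.deriv,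
      h3, ← Complex.real_smul, smul_smul, smul_smul, hCa]

/-- Special conformal symmetries of the equation. -/
theorem IsSolutionAt.comp_specialConformal {m s : ℝ} {P : ℂ → ℂ} (hP : IsPower m P)
    (hsm : s * m = 1 - n / 2) {u v : SpaceTime n → ℂ} (h : IsSolutionAt P u 0) (b : Space n)
    (hv : ∀ t x, 0 < conformalFactor b x →
      v (t, x) = ((conformalFactor b x ^ s : ℝ) : ℂ) * u (t, specialConformal b x)) :
    IsSolutionAt P v 0 := by
  obtain ⟨h1, h2, h3⟩ := h
  simp only [Prod.fst_zero, Prod.snd_zero] at h1 h2 h3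
  have hv0 : ∀ t, v (t, 0) = u (t, 0) := fun t => by
    rw [hv t 0 (by rw [conformalFactor_zero]; exact one_pos), conformalFactor_zero,
      specialConformal_zero]
    simp
  have hPv : (fun x => P (v (0, x))) =ᶠ[𝓝 0] fun x => conformalFactor b x ^ (s * m) •
      (fun x => P (u (0, x))) (specialConformal b x) := by
    filter_upwards [eventually_conformalFactor_pos b] with x hx
    rw [hv 0 x hx, hP.2 _ _ (Real.rpow_pos_of_pos hx s), Complex.real_smul, ← Real.rpow_mul hx.le]
  obtain ⟨h5, h6⟩ := laplacian_comp_specialConformal h2 b hsm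
  refine ⟨?_, ?_, ?_⟩
  · simpa only [Prod.fst_zero, Prod.snd_zero, hv0] using h1
  · exact h5.congr_of_eventuallyEq hPv
  · simp only [Prod.fst_zero, Prod.snd_zero, hv0]
    rw [(InnerProductSpace.laplacian_congr_nhds hPv).self_of_nhds, h6, h3]

/-! ### The action of `Q⁻` and `N` in the non-compact picture -/

theorem apply_inv_mul {p : ZMod 2} {r s : ℝ} (φ : Ind n p r s) (g : G n) (z z' : SpaceTime n)
    {l μ : ℝ} (hl : 0 < l) (hμ : 0 < μ) (h₁ : mat₁ g *ᵥ ![z.1, 1] = l • ![z'.1, 1])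
    (h₂ : mat₂ g *ᵥ cone z.2 = μ • cone z'.2) :
    φ.1 (g⁻¹ * nPlus z') = ((l⁻¹ ^ r * μ⁻¹ ^ s : ℝ) : ℂ) * φ.1 (nPlus z) := by
  refine apply_of_proportional φ _ _ (inv_pos.2 hl) (inv_pos.2 hμ) ?_ ?_
  · rw [mat₁_mul, ← Matrix.mulVec_mulVec, mat₁_nPlus_mulVec, mat₁_nPlus_mulVec,
      eq_inv_smul_iff₀ hl.ne', ← Matrix.mulVec_smul, ← h₁, Matrix.mulVec_mulVec, mat₁_inv_mul,
      Matrix.one_mulVec]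
  · rw [mat₂_mul, ← Matrix.mulVec_mulVec, mat₂_nPlus_mulVec, mat₂_nPlus_mulVec,
      eq_inv_smul_iff₀ hμ.ne', ← Matrix.mulVec_smul, ← h₂, Matrix.mulVec_mulVec, mat₂_inv_mul,
      Matrix.one_mulVec]

theorem norm_add_sq_eq (x y : Space n) : ‖x + y‖ ^ 2 = ‖x‖ ^ 2 + 2 * inner ℝ x y + ‖y‖ ^ 2 :=
  norm_add_sq_real x y

theorem inner_eq_sum (x y : Space n) : inner ℝ x y = ∑ i, x i * y i := by
  simp [PiLp.inner_apply, mul_comm]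

theorem mat₁_nPlus_mulVec_affine (w z : SpaceTime n) :
    mat₁ (nPlus w) *ᵥ ![z.1, 1] = ![(z + w).1, 1] := by
  ext i
  fin_cases i <;> simp [mat₁_nPlus]

theorem nPlusMat_mulVec_cone (w x : Space n) : nPlusMat w *ᵥ cone x = cone (x + w) := by
  have h : ∑ i, w i * (2 * x i) = 2 * inner ℝ x w := by
    rw [inner_eq_sum, Finset.mul_sum]
    exact Finset.sum_congr rfl fun i _ => by ring
  ext k
  rcases k with k | k
  · simp [nPlusMat, cone, Matrix.mulVec, dotProduct, Fintype.sum_sum_type, Matrix.one_apply]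
    ring
  · fin_cases k <;>
    · simp [nPlusMat, cone, Matrix.mulVec, dotProduct, Fintype.sum_sum_type, h, norm_add_sq_eq]
      ring

/-- Shows that `n⁻_{0,b}` acts on `ℝⁿ` by the special conformal map and that its conformal factor is
the scalar on the light cone. The key identity is `σ ‖S x‖² = ‖x‖²` for the map `S` with factor `σ`.
-/
theorem nMinusMat_mulVec_cone (b x : Space n) (h : conformalFactor b x ≠ 0) :
    nMinusMat b *ᵥ cone x = conformalFactor b x • cone (specialConformal b x) := by
  have h1 : ∑ i, b i * (2 * x i) = 2 * inner ℝ b x := by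
    rw [inner_eq_sum, Finset.mul_sum]
    exact Finset.sum_congr rfl fun i _ => by ring
  have h2 : conformalFactor b x * ‖specialConformal b x‖ ^ 2 = ‖x‖ ^ 2 := by
    rw [specialConformal, norm_smul, mul_pow, norm_add_sq_eq, norm_smul, inner_smul_right,
      real_inner_comm]
    simp only [norm_inv, Real.norm_eq_abs, inv_pow, sq_abs, norm_pow, abs_norm]
    field_simp
    rw [conformalFactor]
    ring
  have h3 : conformalFactor b x = 1 + 2 * inner ℝ b x + ‖b‖ ^ 2 * ‖x‖ ^ 2 := rfl
  ext k
  rcases k with k | k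
  · simp [nMinusMat, cone, specialConformal, Matrix.mulVec, dotProduct, Fintype.sum_sum_type,
      Matrix.one_apply]
    field_simp
    ring
  · fin_cases k
    · simp [nMinusMat, cone, Matrix.mulVec, dotProduct, Fintype.sum_sum_type, h1]
      linear_combination -h2 + h3
    · simp [nMinusMat, cone, Matrix.mulVec, dotProduct, Fintype.sum_sum_type, h1]
      linear_combination -h2 - h3

theorem hMat_mulVec_cone (y : ℝ) (x : Space n) :
    hMat n y *ᵥ cone x = Real.exp (-y) • cone (Real.exp y • x) := by
  have h : Real.exp (-y) * Real.exp y = 1 := by rw [← Real.exp_add]; simp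
  have hn : ‖Real.exp y • x‖ ^ 2 = Real.exp y ^ 2 * ‖x‖ ^ 2 := by
    rw [norm_smul, mul_pow, Real.norm_eq_abs, sq_abs]
  ext k
  rcases k with k | k
  · simp [hMat, cone, Matrix.mulVec, dotProduct, Fintype.sum_sum_type, Matrix.one_apply]
    linear_combination (-2 * x k) * h
  · have h1 := Real.cosh_eq y
    have h2 := Real.sinh_eq y
    fin_cases k <;>
    · simp [hMat, cone, Matrix.mulVec, dotProduct, Fintype.sum_sum_type, hn, h1, h2]
      linear_combination (-Real.exp y * ‖x‖ ^ 2) * h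

/-- The rotation of `ℝⁿ` that corresponds to an orthogonal matrix. -/
def rotation (B : Matrix.specialOrthogonalGroup (Fin n) ℝ) : Space n ≃ₗᵢ[ℝ] Space n :=
  LinearIsometry.toLinearIsometryEquiv
    { toLinearMap := Matrix.toLpLin 2 2 (B : Matrix (Fin n) (Fin n) ℝ)
      norm_map' := fun x => by
        have hB : (B : Matrix (Fin n) (Fin n) ℝ)ᵀ * (B : Matrix (Fin n) (Fin n) ℝ) = 1 :=
          (Matrix.mem_orthogonalGroup_iff' (Fin n) ℝ).1
            (Matrix.mem_specialOrthogonalGroup_iff.1 B.2).1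
        rw [← sq_eq_sq₀ (norm_nonneg _) (norm_nonneg _), norm_sq_eq_sum, norm_sq_eq_sum]
        change (B : Matrix (Fin n) (Fin n) ℝ) *ᵥ x.ofLp ⬝ᵥ
          (B : Matrix (Fin n) (Fin n) ℝ) *ᵥ x.ofLp = x.ofLp ⬝ᵥ x.ofLp
        rw [Matrix.dotProduct_mulVec, ← Matrix.mulVec_transpose, Matrix.mulVec_mulVec, hB,
          Matrix.one_mulVec] } rfl

theorem rotation_apply (B : Matrix.specialOrthogonalGroup (Fin n) ℝ) (x : Space n) (i : Fin n) :
    rotation B x i = ∑ j, (B : Matrix (Fin n) (Fin n) ℝ) i j * x j := rfl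

theorem mMat_mulVec_cone (B : Matrix.specialOrthogonalGroup (Fin n) ℝ) (x : Space n) :
    mMat (B : Matrix (Fin n) (Fin n) ℝ) *ᵥ cone x = cone (rotation B x) := by
  ext k
  rcases k with k | k
  · simp [mMat, cone, Matrix.mulVec, dotProduct, Fintype.sum_sum_type, rotation_apply,
      Finset.mul_sum, mul_left_comm]
  · fin_cases k <;>
    simp [mMat, cone, Matrix.mulVec, dotProduct, Fintype.sum_sum_type]

theorem nPlusMat_mul_neg (x : Space n) : nPlusMat x * nPlusMat (-x) = 1 := by
  rw [nPlusMat, nPlusMat, fromBlocks_multiply, ← fromBlocks_one]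
  congr 1
  · ext i j
    simp [Matrix.mul_apply]
  · ext i j
    fin_cases j <;> simp [Matrix.mul_apply] <;> ring
  · ext i j
    rw [Matrix.add_apply, Matrix.mul_apply, Matrix.mul_apply, Fin.sum_univ_two]
    fin_cases i <;> simp [Matrix.one_apply] <;> ring
  · ext i j
    fin_cases i <;> fin_cases j <;> simp [Matrix.mul_apply, norm_sq_eq_sum] <;> ring

theorem nMinus_neg (b : Space n) : nMinus (0, -b) = (nMinus (0, b))⁻¹ := by
  refine eq_inv_of_mul_eq_one_right (ext_mat ?_ ?_)
  · simp [mat₁_nMinus, ← Matrix.one_fin_two]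
  · rw [mat₂_mul, mat₂_nMinus, mat₂_nMinus, nMinusMat_eq_transpose, nMinusMat_eq_transpose,
      ← transpose_mul]
    have := nPlusMat_mul_neg (-b)
    rw [neg_neg] at this
    rw [this, transpose_one, mat₂_one]

section Local

variable {m : ℝ} {p : ZMod 2} {r s : ℝ} {P : ℂ → ℂ}

theorem solution_translate {φ : Ind n p r s} {z : SpaceTime n} (w : SpaceTime n)
    (h : IsSolutionAt P (restrict n p r s φ) (z - w)) :
    IsSolutionAt P (restrict n p r s (leftTranslation n p r s (nPlus w) φ)) z := by
  rw [sub_eq_add_neg] at h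
  refine h.comp_add fun y => ?_
  change φ.1 ((nPlus w)⁻¹ * nPlus y) = φ.1 (nPlus (y + -w))
  rw [apply_inv_mul φ (nPlus w) (y + -w) y one_pos one_pos]
  · simp
  · rw [mat₁_nPlus_mulVec_affine, neg_add_cancel_right, one_smul]
  · rw [mat₂_nPlus, nPlusMat_mulVec_cone, ← Prod.snd_add, neg_add_cancel_right, one_smul]

theorem solution_translate_inv {φ : Ind n p r s} {z : SpaceTime n} (w : SpaceTime n)
    (h : IsSolutionAt P (restrict n p r s φ) (z + w)) :
    IsSolutionAt P (restrict n p r s (leftTranslation n p r s (nPlus w)⁻¹ φ)) z := by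
  refine h.comp_add fun y => ?_
  change φ.1 ((nPlus w)⁻¹⁻¹ * nPlus y) = φ.1 (nPlus (y + w))
  rw [inv_inv, apply_of_proportional φ (nPlus w * nPlus y) (nPlus (y + w)) one_pos one_pos]
  · simp
  · rw [mat₁_mul, ← Matrix.mulVec_mulVec, mat₁_nPlus_mulVec, mat₁_nPlus_mulVec_affine,
      mat₁_nPlus_mulVec, one_smul]
  · rw [mat₂_mul, ← Matrix.mulVec_mulVec, mat₂_nPlus_mulVec, mat₂_nPlus_mulVec, mat₂_nPlus,
      nPlusMat_mulVec_cone, one_smul, Prod.snd_add]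

theorem solution_levi (hm1 : m ≠ 1) (hr : r = -2 / (m - 1)) (hs : s = 2 / (m - 1))
    (hP : IsPower m P) {φ : Ind n p r s} {g : G n} {a y : ℝ} (ha : 0 < a)
    (B : Matrix.specialOrthogonalGroup (Fin n) ℝ) (hg₁ : mat₁ g = !![a, 0; 0, a⁻¹])
    (hg₂ : mat₂ g = mMat (B : Matrix (Fin n) (Fin n) ℝ) * hMat n y)
    (h : IsSolutionAt P (restrict n p r s φ) 0) :
    IsSolutionAt P (restrict n p r s (leftTranslation n p r s g φ)) 0 := by
  have hm1' : m - 1 ≠ 0 := sub_ne_zero.2 hm1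
  have hC : 0 < a ^ r * Real.exp y ^ s :=
    mul_pos (Real.rpow_pos_of_pos ha r) (Real.rpow_pos_of_pos (Real.exp_pos y) s)
  refine h.comp_similarity hP (rotation B).symm (C := a ^ r * Real.exp y ^ s) (a := a⁻¹ ^ 2)
    (c := Real.exp (-y)) hC ?_ fun t x => ?_
  · rw [← Real.exp_log ha, ← Real.exp_neg, ← Real.exp_mul, ← Real.exp_mul, ← Real.exp_add,
      ← Real.exp_mul, ← Real.exp_nat_mul, ← Real.exp_nat_mul, ← Real.exp_add, ← Real.exp_add,
      hr, hs]
    congr 1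
    push_cast
    field_simp
    ring
  · change φ.1 (g⁻¹ * nPlus (t, x)) = _ * φ.1 (nPlus _)
    -- The point that `g` sends to `(t, x)`; the scalars are `a⁻¹` on `ℝ²` and `e^{-y}` on the light
    -- cone.
    rw [apply_inv_mul φ g (a⁻¹ ^ 2 * t, Real.exp (-y) • (rotation B).symm x) (t, x)
      (inv_pos.2 ha) (Real.exp_pos (-y)), inv_inv, ← Real.exp_neg, neg_neg]
    · rw [hg₁]
      ext i
      fin_cases i
      · simp
        field_simp
      · simp
    · rw [hg₂, ← Matrix.mulVec_mulVec, hMat_mulVec_cone, Matrix.mulVec_smul, mMat_mulVec_cone,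
        smul_smul, ← Real.exp_add, add_neg_cancel, Real.exp_zero, one_smul,
        LinearIsometryEquiv.apply_symm_apply]

theorem solution_nMinus (hsm : s * m = 1 - n / 2) (hP : IsPower m P) {φ : Ind n p r s}
    (b : Space n) (h : IsSolutionAt P (restrict n p r s φ) 0) :
    IsSolutionAt P (restrict n p r s (leftTranslation n p r s (nMinus (0, b)) φ)) 0 := by
  refine h.comp_specialConformal hP hsm (-b) fun t x hx => ?_
  change φ.1 ((nMinus (0, b))⁻¹ * nPlus (t, x)) = _ * φ.1 (nPlus _)
  rw [← nMinus_neg, apply_of_proportional φ _ (nPlus (t, specialConformal (-b) x)) one_pos hx,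
    Real.one_rpow, one_mul]
  · rw [mat₁_mul, ← Matrix.mulVec_mulVec, mat₁_nPlus_mulVec, mat₁_nPlus_mulVec, mat₁_nMinus]
    simp [← Matrix.one_fin_two]
  · rw [mat₂_mul, ← Matrix.mulVec_mulVec, mat₂_nPlus_mulVec, mat₂_nPlus_mulVec, mat₂_nMinus,
      nMinusMat_mulVec_cone _ _ hx.ne']

end Local

/-! ### The symmetry group -/

/-- The null vector `(0, 1, 1)`, the point at infinity of the conformal compactification. -/
def infVec (n : ℕ) : Idx n → ℝ := Sum.elim 0 1

theorem smul_inv_mulVec {ι : Type*} [Fintype ι] [DecidableEq ι] {A A' : Matrix ι ι ℝ}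
    (h : A' * A = 1) {v : ι → ℝ} {c : ℝ} (hc : c ≠ 0) (hv : A *ᵥ v = c • v) :
    A' *ᵥ v = c⁻¹ • v := by
  rw [eq_inv_smul_iff₀ hc, ← Matrix.mulVec_smul, ← hv, Matrix.mulVec_mulVec, h, Matrix.one_mulVec]

/-- Translations, rotations and dilations of `ℝⁿ` fix infinity. Only the `W_i` move it, and they are
excluded by the value of `m`. -/
theorem alg_snd_mulVec_infVec {m : ℝ} (hm : m ≠ ((n : ℝ) - 2) / ((n : ℝ) + 2)) {X : Gen n}
    (hX : X.IsSymmetry m) : ∃ a : ℝ, X.alg.2 *ᵥ infVec n = a • infVec n := by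
  cases X with
  | X2 =>
    refine ⟨1, ?_⟩
    ext k
    rcases k with k | k
    · simp [Gen.alg, infVec, Matrix.add_mulVec, E_mulVec]
    · fin_cases k <;> simp [Gen.alg, infVec, Matrix.add_mulVec, E_mulVec]
  | W i => exact absurd hX hm
  | _ =>
    refine ⟨0, ?_⟩
    ext k
    simp [Gen.alg, infVec, Matrix.add_mulVec, Matrix.sub_mulVec, E_mulVec]

theorem symAlg_snd_mulVec_infVec {m : ℝ} (hm : m ≠ ((n : ℝ) - 2) / ((n : ℝ) + 2))
    {c : Gen n →₀ ℝ} (hc : IsSymmetryCoeff m c) :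
    ∃ a : ℝ, (symAlg c).2 *ᵥ infVec n = a • infVec n := by
  choose! a ha using fun (X : Gen n) (hX : X ∈ c.support) => alg_snd_mulVec_infVec hm (hc X hX)
  refine ⟨∑ X ∈ c.support, c X * a X, ?_⟩
  rw [symAlg, Finsupp.linearCombination_apply, Finsupp.sum, Prod.snd_sum, Matrix.sum_mulVec,
    Finset.sum_smul]
  refine Finset.sum_congr rfl fun X hX => ?_
  rw [Prod.smul_snd, Matrix.smul_mulVec, ha X hX, smul_smul]

/-- Every generator, the `W_i` included, has an upper triangular `SL(2)` part, and exponentials have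
positive eigenvalue on `(1, 0)`. So no inversion in time and no sign `(-1)^j` can occur. -/
theorem symmetryGroup_mat₁ {m : ℝ} {g : G n} (hg : g ∈ symmetryGroup n m) :
    ∃ a : ℝ, 0 < a ∧ mat₁ g *ᵥ ![1, 0] = a • ![1, 0] := by
  induction hg using Subgroup.closure_induction with
  | mem g hg =>
    obtain ⟨c, ε, -, hε⟩ := hg
    obtain ⟨α, β, h⟩ := symAlg_fst c
    refine ⟨_, Real.exp_pos (ε * α), ?_⟩
    rw [hε.1, exp_smul_mulVec_of_eigenvector]
    rw [h]
    ext i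
    fin_cases i <;> simp
  | one => exact ⟨1, one_pos, by simp⟩
  | mul g h _ _ hg hh =>
    obtain ⟨a, ha, hg⟩ := hg
    obtain ⟨b, hb, hh⟩ := hh
    exact ⟨b * a, mul_pos hb ha, by
      rw [mat₁_mul, ← Matrix.mulVec_mulVec, hh, Matrix.mulVec_smul, hg, smul_smul]⟩
  | inv g _ hg =>
    obtain ⟨a, ha, hg⟩ := hg
    exact ⟨a⁻¹, inv_pos.2 ha, smul_inv_mulVec (mat₁_inv_mul g) ha.ne' hg⟩

theorem symmetryGroup_mat₂ {m : ℝ} (hm : m ≠ ((n : ℝ) - 2) / ((n : ℝ) + 2)) {g : G n}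
    (hg : g ∈ symmetryGroup n m) : ∃ a : ℝ, 0 < a ∧ mat₂ g *ᵥ infVec n = a • infVec n := by
  induction hg using Subgroup.closure_induction with
  | mem g hg =>
    obtain ⟨c, ε, hc, hε⟩ := hg
    obtain ⟨a, ha⟩ := symAlg_snd_mulVec_infVec hm hc
    exact ⟨_, Real.exp_pos (ε * a), by rw [hε.2, exp_smul_mulVec_of_eigenvector _ ha]⟩
  | one => exact ⟨1, one_pos, by simp⟩
  | mul g h _ _ hg hh =>
    obtain ⟨a, ha, hg⟩ := hg
    obtain ⟨b, hb, hh⟩ := hh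
    exact ⟨b * a, mul_pos hb ha, by
      rw [mat₂_mul, ← Matrix.mulVec_mulVec, hh, Matrix.mulVec_smul, hg, smul_smul]⟩
  | inv g _ hg =>
    obtain ⟨a, ha, hg⟩ := hg
    exact ⟨a⁻¹, inv_pos.2 ha, smul_inv_mulVec (mat₂_inv_mul g) ha.ne' hg⟩

theorem mat₁_nPlus_mulVec_fixed (z : SpaceTime n) : mat₁ (nPlus z) *ᵥ ![1, 0] = ![1, 0] := by
  ext i
  fin_cases i <;> simp [mat₁_nPlus]

theorem nPlusMat_mulVec_infVec (x : Space n) : nPlusMat x *ᵥ infVec n = infVec n := by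
  ext k
  rcases k with k | k
  · simp [nPlusMat, infVec, Matrix.mulVec, dotProduct, Fintype.sum_sum_type]
  · fin_cases k <;> simp [nPlusMat, infVec, Matrix.mulVec, dotProduct, Fintype.sum_sum_type]

theorem IsQMinus.of_upper {k : QParam n} {q : G n} (hq : IsQMinus k q) {a : ℝ} (ha : 0 < a)
    (h : mat₁ q *ᵥ ![1, 0] = a • ![1, 0]) : mat₁ q = !![k.a, 0; 0, k.a⁻¹] := by
  have hk := k.a_pos
  rw [hq.1] at h ⊢
  have h0 := congrFun h 0
  have h1 := congrFun h 1
  have hj : k.j.val = 0 ∨ k.j.val = 1 := by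
    have := ZMod.val_lt k.j
    omega
  rcases hj with hj | hj
  · rw [hj] at h0 h1 ⊢
    have ht : k.t = 0 := by simpa [hk.ne'] using h1
    rw [ht]
    simp [← Matrix.one_fin_two]
  · rw [hj] at h0
    simp at h0
    linarith

/-- The first `n` coordinates of `q (0, 1, 1)` are `2 B x`: `n⁻` produces `2x`, `h` leaves it alone
and `m` rotates it. -/
theorem IsQMinus.eq_zero {k : QParam n} {q : G n} (hq : IsQMinus k q) {a : ℝ}
    (h : mat₂ q *ᵥ infVec n = a • infVec n) : k.x = 0 := by
  have h1 : (rotation k.B) k.x = 0 := by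
    ext i
    have h2 := congrFun h (.inl i)
    have h3 : ∀ l, (nMinusMat k.x *ᵥ infVec n) (.inl l) = 2 * k.x l := fun l => by
      simp [nMinusMat, infVec, Matrix.mulVec, dotProduct, Fintype.sum_sum_type]
      ring
    have h4 : ∀ (w : Idx n → ℝ) l, (hMat n k.y *ᵥ w) (.inl l) = w (.inl l) := fun w l => by
      simp [hMat, Matrix.mulVec, dotProduct, Fintype.sum_sum_type, Matrix.one_apply]
    have h5 : ∀ (w : Idx n → ℝ) l, (mMat (k.B : Matrix (Fin n) (Fin n) ℝ) *ᵥ w) (.inl l) =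
        ∑ j, (k.B : Matrix (Fin n) (Fin n) ℝ) l j * w (.inl j) := fun w l => by
      simp [mMat, Matrix.mulVec, dotProduct, Fintype.sum_sum_type]
    rw [hq.2, ← Matrix.mulVec_mulVec, ← Matrix.mulVec_mulVec, h5] at h2
    simp only [h4, h3] at h2
    simp only [Pi.smul_apply, infVec, Sum.elim_inl, Pi.zero_apply, smul_zero,
      mul_left_comm _ (2 : ℝ), ← Finset.mul_sum] at h2
    rw [rotation_apply]
    simpa using h2
  simpa using h1

theorem solution_of_mem_symmetryGroup {m : ℝ} (hm1 : m ≠ 1) {p : ZMod 2} {r s : ℝ}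
    (hr : r = -2 / (m - 1)) (hs : s = 2 / (m - 1)) {P : ℂ → ℂ} (hP : IsPower m P) {g : G n}
    (hg : g ∈ symmetryGroup n m) (φ : Ind n p r s) {z z' : SpaceTime n} {k : QParam n} {q : G n}
    (hk : IsQMinus k q) (hz : g * nPlus z = nPlus z' * q)
    (h : IsSolutionAt P (restrict n p r s φ) z) :
    IsSolutionAt P (restrict n p r s (leftTranslation n p r s g φ)) z' := by
  have hq : q = (nPlus z')⁻¹ * (g * nPlus z) := by rw [hz, inv_mul_cancel_left]
  have hq₁ : mat₁ q = !![k.a, 0; 0, k.a⁻¹] := by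
    obtain ⟨a, ha, hga⟩ := symmetryGroup_mat₁ hg
    refine hk.of_upper ha ?_
    have h1 := smul_inv_mulVec (mat₁_inv_mul (nPlus z')) one_ne_zero
      (by rw [mat₁_nPlus_mulVec_fixed, one_smul])
    rw [hq, mat₁_mul, mat₁_mul, ← Matrix.mulVec_mulVec, ← Matrix.mulVec_mulVec,
      mat₁_nPlus_mulVec_fixed, hga, Matrix.mulVec_smul, h1, inv_one, one_smul]
  -- Either the special conformal factor is absent, or `m - 1 = -4/(n+2)` and `s = -(n+2)/2`, so
  -- that the weight is the conformal one.
  have hx : k.x = 0 ∨ s * m = 1 - n / 2 := by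
    by_cases hm : m = ((n : ℝ) - 2) / ((n : ℝ) + 2)
    · right
      have h2 : (n : ℝ) + 2 ≠ 0 := by positivity
      have h3 : m - 1 = -4 / ((n : ℝ) + 2) := by rw [hm]; field_simp; ring
      rw [hs, h3, hm]
      field_simp
      ring
    · left
      obtain ⟨a, ha, hga⟩ := symmetryGroup_mat₂ hm hg
      refine hk.eq_zero (a := a) ?_
      have h1 := smul_inv_mulVec (mat₂_inv_mul (nPlus z')) one_ne_zero
        (by rw [mat₂_nPlus, nPlusMat_mulVec_infVec, one_smul])
      rw [hq, mat₂_mul, mat₂_mul, ← Matrix.mulVec_mulVec, ← Matrix.mulVec_mulVec, mat₂_nPlus z,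
        nPlusMat_mulVec_infVec, hga, Matrix.mulVec_smul, h1, inv_one, one_smul]
  -- Removing `n⁻` from `q` leaves the Levi factor `q n⁻_{0,-b}`, with `b = k.x`. Read from the
  -- right, the factors move `z` to the origin, act there with the origin fixed, and move it to
  -- `z'`.
  have hdec : g = nPlus z' * ((q * nMinus (0, -k.x)) * (nMinus (0, k.x) * (nPlus z)⁻¹)) := by
    rw [nMinus_neg, hq]
    group
  have hlevi₁ : mat₁ (q * nMinus (0, -k.x)) = !![k.a, 0; 0, k.a⁻¹] := by
    rw [mat₁_mul, hq₁, mat₁_nMinus]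
    simp [← Matrix.one_fin_two]
  have hlevi₂ : mat₂ (q * nMinus (0, -k.x)) =
      mMat (k.B : Matrix (Fin n) (Fin n) ℝ) * hMat n k.y := by
    have h1 : nMinusMat k.x * nMinusMat (-k.x) = 1 := by
      have := nPlusMat_mul_neg (-k.x)
      rw [neg_neg] at this
      rw [nMinusMat_eq_transpose, nMinusMat_eq_transpose, ← transpose_mul, this, transpose_one]
    rw [mat₂_mul, hk.2, mat₂_nMinus, Matrix.mul_assoc, h1, Matrix.mul_one]
  generalize q * nMinus (0, -k.x) = q' at hdec hlevi₁ hlevi₂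
  rw [hdec, map_mul, map_mul, map_mul]
  refine solution_translate z' ?_
  rw [sub_self]
  refine solution_levi hm1 hr hs hP k.a_pos k.B hlevi₁ hlevi₂ ?_
  have h0 : IsSolutionAt P
      (restrict n p r s (leftTranslation n p r s (nPlus z)⁻¹ φ)) 0 :=
    solution_translate_inv z (by rwa [zero_add])
  rcases hx with hx | hx
  · have h1 : nMinus ((0 : ℝ), k.x) = 1 := by rw [hx]; exact nMinus_zero
    rw [h1, map_one]
    exact h0
  · exact solution_nMinus hx hP k.x h0

end PorousMedium

end

/-! ### The main theorem. -/

open PorousMedium in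
theorem mainTheorem1 (n : ℕ) (hn : 1 ≤ n) (m : ℝ) (hm0 : m ≠ 0) (hm1 : m ≠ 1) (p : ZMod 2)
    (r s : ℝ) (hr : r = -2 / (m - 1)) (hs : s = 2 / (m - 1)) :
    (∀ f ∈ I' n p r s, ContDiff ℝ ∞ f) ∧
    Function.Injective (restrict n p r s) ∧
    ∃ ρ : Representation ℂ (G n) (I' n p r s),
      (∀ (g : G n) (φ : Ind n p r s),
        ρ g ((restrict n p r s).rangeRestrict φ) =
          (restrict n p r s).rangeRestrict (leftTranslation n p r s g φ)) ∧
      (∀ c : Gen n →₀ ℝ, IsSymmetryCoeff m c → ∀ ε : ℝ,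
        ∃ g ∈ symmetryGroup n m, IsExp c ε g ∧
          ∀ (f : I' n p r s) (z z' : SpaceTime n) (u' : ℂ),
            FlowsTo (symField m c) ε (z, f.1 z) (z', u') → (ρ g f).1 z' = u') ∧
      (∀ g ∈ symmetryGroup n m, ∀ P : ℂ → ℂ, IsPower m P →
        ∀ (f : I' n p r s) (U : Set (SpaceTime n)), IsOpen U →
          IsSolutionOn P f.1 U → IsSolutionOn P (ρ g f).1 (baseImage g U)) := by
  refine ⟨?_, restrict_injective hn p r s, action hn p r s, action_restrict hn p r s, ?_, ?_⟩
  · rintro f ⟨φ, rfl⟩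
    exact contDiff_restrict φ.2.1
  · intro c hc ε
    obtain ⟨g, hg⟩ := exists_isExp c ε
    refine ⟨g, Subgroup.subset_closure ⟨c, ε, hc, hg⟩, hg, ?_⟩
    rintro ⟨f, φ, rfl⟩ z z' u' hflow
    have h := congrArg Subtype.val (action_restrict hn p r s g φ)
    exact (congrFun h z').trans (apply_of_flowsTo hr hs hg φ hflow)
  · rintro g hg P hP ⟨f, φ, rfl⟩ U - hU z' ⟨z, hz, q, k, hk, hgz⟩
    have h := congrArg Subtype.val (action_restrict hn p r s g φ)
    -- Being a solution on a set is a condition at each of its points, so it suffices to transport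
    -- it from `z` to `z'`.
    have h1 := solution_of_mem_symmetryGroup hm1 hr hs hP hg φ hk hgz (hU z hz)
    change IsSolutionAt P _ z'
    convert h1 using 1
    exact h
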